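/- **Setting.** Let $D\ge 1$ be an integer and $\alpha>D$ real. Let $\Lambda$ be the finite vertex set of a connected graph with shortest-path distance $d_{i,i'}$; write $i[r]=\{j\in\Lambda: d_{i,j}\le r\}$ and $\partial i[r]=\{j\in\Lambda: d_{i,j}=r\}$. The graph is a $D$-dimensional lattice with constant $\gamma\ge1$, that is, $|i[r]|\le\gamma r^D$ and $|\partial i[r]|\le\gamma r^{D-1}$ for all $i\in\Lambda$ and all integers $r\ge1$. A spin $1/2$ sits at each vertex. Let $H=\sum_{Z\subseteq\Lambda,\,|Z|\le k}h_Z$, where $h_Z$ is Hermitian and acts on the spins in $Z$ only, and $$\sum_{Z\supseteq\{i,i'\}}\|h_Z\|\le J_0\,(d_{i,i'}+1)^{-\alpha}\qquad\text{for all } i,i'\in\Lambda ,$$ with $\|\cdot\|$ the operator norm. Put $W(t)=e^{iHt}We^{-iHt}$ and $\|O\|_F=\sqrt{\mathrm{tr}(O^\dagger O)/\mathrm{tr}(\hat 1)}$. Let $\lambda$ be such that $\sum_{j\in\Lambda}(d_{i,j}+1)^{-\alpha}(d_{j,i'}+1)^{-\alpha}\le\lambda(d_{i,i'}+1)^{-\alpha}$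 for all $i,i'\in\Lambda$. Let $g$ be such that, for each site $i$, the absolute values of the coefficients of all Pauli products acting nontrivially at $i$ in the Pauli expansions of the terms $h_Z$ with $Z\ni i$ sum to at most $g$. Let $J=3^{k/2}J_0$ if each $h_Z$ is a combination of the $3^{|Z|}$ Pauli products that are nontrivial exactly at the sites of $Z$, and $J=4^{k/2}J_0$ otherwise. Put $\tilde g=\max(gk,\lambda J)$ and $$C_0=\frac{2^{\alpha-D/2+2}J_0\gamma}{2\alpha-D-1}+\frac{80\,\tilde g\,\gamma\,2^{\alpha-D/2}}{\alpha-D}\sqrt{2\alpha-2D+\gamma}.$$ **Theorem 1.** 1. Let $t>0$ and $\Delta t>0$ with $2e\tilde g\,\Delta t<1$ and $t/\Delta t\in\mathbb N$, and let $R\ge1$ be an integer multiple of $t/\Delta t$. For each $i\in\Lambda$ and each operator $W_i$ on the site $i$ with $\|W_i\|=1$ there is an operator $\tilde W_{i[R]}$ supported on $i[R]$ such that $$\|W_i(t)-\tilde W_{i[R]}\|_F\le 2^{D-1}C_0\,(\Delta t)^{-\alpha+\frac{D+1}2}\,t^{\alpha-\frac{D-1}2}\,R^{-\alpha+D}.$$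 2. Let $d_{i,i'}=R\ge1$, let $W_i$ and $V_{i'}$ be operators on the sites $i$ and $i'$ with $\|W_i\|=\|V_{i'}\|=1$, and let $C(R,t)=\mathrm{tr}\big([W_i(t),V_{i'}]^\dagger[W_i(t),V_{i'}]\big)/\mathrm{tr}(\hat1)$ be the out-of-time-order correlator. Then $C(R,t)\le4\,\|W_i(t)-W'\|_F^2$ for all real $t$ and every operator $W'$ supported on $i[R-1]$. 3. For every $t_0>0$ there are constants $C,C'>0$ that depend only on $D,\alpha,\gamma,k,J_0,t_0$ such that for all systems as above, all $t\ge t_0$, all $i$ and all $W_i$ with $\|W_i\|=1$: for each integer $r\ge1$ there is an operator $W'$ supported on $i[r]$ with $$\|W_i(t)-W'\|_F\le C\,r^{-\alpha+D}\,t^{\alpha-\frac{D-1}2},$$ and for every $V_{i'}$ with $\|V_{i'}\|=1$ and $d_{i,i'}=R\ge1$, $$C(R,t)\le\left(\frac{C't}{R^{\frac{2\alpha-2D}{2\alpha-D+1}}}\right)^{\alpha-\frac{D-1}2}.$$ -/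

import Mathlib

noncomputable section

namespace LongRange

open scoped Matrix

/-- Operators on the Hilbert space `(ℂ²)^{⊗Λ}` of spins `1/2` on the sites `Λ`, as matrices in the
product basis, which is labelled by the configurations `Λ → Fin 2`. -/
abbrev Op (Λ : Type*) := Matrix (Λ → Fin 2) (Λ → Fin 2) ℂ

section Lattice

variable {Λ : Type*} [Fintype Λ]

/-- The ball `i[r]` for the shortest-path distance. -/
def ball (G : SimpleGraph Λ) (i : Λ) (r : ℕ) : Finset Λ :=
  Finset.univ.filter fun j => G.dist i j ≤ r

/-- The surface `∂(i[r])` of the ball `i[r]`: the sites at distance exactly `r` from `i`. -/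
def sphere (G : SimpleGraph Λ) (i : Λ) (r : ℕ) : Finset Λ :=
  Finset.univ.filter fun j => G.dist i j = r

/-- The graph `G` is a `D`-dimensional lattice with lattice constant `γ`. -/
structure IsLattice (G : SimpleGraph Λ) (D : ℕ) (γ : ℝ) : Prop where
  connected : G.Connected
  one_le : 1 ≤ γ
  card_ball : ∀ (i : Λ) (r : ℕ), 1 ≤ r → ((ball G i r).card : ℝ) ≤ γ * (r : ℝ) ^ D
  card_sphere : ∀ (i : Λ) (r : ℕ), 1 ≤ r → ((sphere G i r).card : ℝ) ≤ γ * (r : ℝ) ^ (D - 1)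

end Lattice

section Operators

variable {Λ : Type*} [Fintype Λ] [DecidableEq Λ]

/-- The operator norm with respect to the Hermitian inner product. -/
def opNorm (A : Op Λ) : ℝ := ‖Matrix.toEuclideanCLM (n := Λ → Fin 2) (𝕜 := ℂ) A‖

/-- The normalized trace `tr(A) / tr(1)`. -/
def ntr (A : Op Λ) : ℂ := Matrix.trace A / Matrix.trace (1 : Op Λ)

/-- The normalized Frobenius norm `√(tr(A† A) / tr(1))`. -/
def frobNorm (A : Op Λ) : ℝ := Real.sqrt (ntr (Aᴴ * A)).re

/-- `A` acts on the spins in `X` only: `A = B ⊗ 1` with `B` an operator on the spins in `X` and `1`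
the identity on the other spins. -/
def SupportedOn (X : Finset Λ) (A : Op Λ) : Prop :=
  ∃ B : Op X, ∀ σ τ : Λ → Fin 2,
    A σ τ = if ∀ i, i ∉ X → σ i = τ i then B (fun i => σ i) (fun i => τ i) else 0

/-- The Heisenberg evolution `W(t) = e^{iHt} W e^{-iHt}`. -/
def evolve (H : Op Λ) (t : ℝ) (W : Op Λ) : Op Λ :=
  NormedSpace.exp ((Complex.I * (t : ℂ)) • H) * W * NormedSpace.exp ((-(Complex.I * (t : ℂ))) • H)

/-- The out-of-time-order correlator `tr([W(t), V]† [W(t), V]) / tr(1)`. -/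
def otoc (H : Op Λ) (t : ℝ) (W V : Op Λ) : ℝ :=
  (ntr ((evolve H t W * V - V * evolve H t W)ᴴ * (evolve H t W * V - V * evolve H t W))).re

/-- The matrices `1, σˣ, σʸ, σᶻ`. -/
def pauli : Fin 4 → Matrix (Fin 2) (Fin 2) ℂ :=
  ![1, !![0, 1; 1, 0], !![0, -Complex.I; Complex.I, 0], !![1, 0; 0, -1]]

/-- The product over all sites `i` of the Pauli matrix with label `p i` at `i`
(label `0` is the identity). -/
def pauliProd (p : Λ → Fin 4) : Op Λ := fun σ τ => ∏ i, pauli (p i) (σ i) (τ i)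

/-- The coefficient of the Pauli product `pauliProd p` in the Pauli expansion of `A`. -/
def pauliCoeff (p : Λ → Fin 4) (A : Op Λ) : ℂ := ntr (pauliProd p * A)

/-- `A` is a combination of the `3^|Z|` Pauli products that are different from the identity at each
site of `Z` and equal to the identity elsewhere. -/
def IsPauliSumOn (Z : Finset Λ) (A : Op Λ) : Prop :=
  A ∈ Submodule.span ℂ {P : Op Λ | ∃ p : Λ → Fin 4, (∀ i, p i ≠ 0 ↔ i ∈ Z) ∧ P = pauliProd p}

end Operators

section Hamiltonian

variable {Λ : Type*} [Fintype Λ] [DecidableEq Λ]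

/-- The Hamiltonian `H = ∑_Z h_Z`. -/
def hamiltonian (h : Finset Λ → Op Λ) : Op Λ := ∑ Z, h Z

/-- The terms `h_Z` define a `k`-local Hamiltonian whose interactions decay with the power `α`:
`∑_{Z ⊇ {i, i'}} ‖h_Z‖ ≤ J₀ (d_{i,i'} + 1)^{-α}` for all sites `i, i'`. -/
structure IsPowerLaw (G : SimpleGraph Λ) (h : Finset Λ → Op Λ) (k : ℕ) (α J₀ : ℝ) : Prop where
  hermitian : ∀ Z, (h Z).IsHermitian
  supported : ∀ Z, SupportedOn Z (h Z)
  klocal : ∀ Z, k < Z.card → h Z = 0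
  decay : ∀ i i' : Λ, ∑ Z ∈ Finset.univ.filter (fun Z : Finset Λ => i ∈ Z ∧ i' ∈ Z), opNorm (h Z)
    ≤ J₀ * ((G.dist i i' : ℝ) + 1) ^ (-α)

/-- `lam` is a constant for which the power law reproduces itself under convolution. -/
def IsConvConst (G : SimpleGraph Λ) (α lam : ℝ) : Prop :=
  ∀ i i' : Λ, ∑ j, ((G.dist i j : ℝ) + 1) ^ (-α) * ((G.dist j i' : ℝ) + 1) ^ (-α)
    ≤ lam * ((G.dist i i' : ℝ) + 1) ^ (-α)

/-- `g` bounds the one-site energies: for each site `i`, the absolute values of the coefficients of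
the Pauli products that act at `i`, over all terms `h_Z` with `i ∈ Z`, sum to at most `g`. -/
def IsSiteEnergy (h : Finset Λ → Op Λ) (g : ℝ) : Prop :=
  ∀ i : Λ, ∑ Z ∈ Finset.univ.filter (fun Z : Finset Λ => i ∈ Z),
    ∑ p ∈ Finset.univ.filter (fun p : Λ → Fin 4 => p i ≠ 0), ‖pauliCoeff p (h Z)‖ ≤ g

open Classical in
/-- The number of Pauli matrices needed per site in the Pauli expansion of the terms `h_Z`: three if
each `h_Z` is a combination of the `3^|Z|` Pauli products that are nontrivial at each site of `Z`,
and four (the identity included) otherwise. -/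
def pauliBase (h : Finset Λ → Op Λ) : ℝ := if ∀ Z, IsPauliSumOn Z (h Z) then 3 else 4

/-- `g̃ = max (g k, λ J)` with `J = 3^{k/2} J₀`, or `J = 4^{k/2} J₀` if some `h_Z` is not a
combination of Pauli products that are nontrivial at each site of `Z`. -/
def gTilde (h : Finset Λ → Op Λ) (k : ℕ) (J₀ lam g : ℝ) : ℝ :=
  max (g * k) (lam * (pauliBase h ^ ((k : ℝ) / 2) * J₀))

end Hamiltonian

/-- The constant `C₀`; `gt` stands for `g̃`. -/
def C₀ (D : ℕ) (α γ J₀ gt : ℝ) : ℝ :=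
  (2 : ℝ) ^ (α - (D : ℝ) / 2 + 2) * J₀ * γ / (2 * α - D - 1)
    + 80 * gt * γ * (2 : ℝ) ^ (α - (D : ℝ) / 2) / (α - D) * Real.sqrt (2 * α - 2 * D + γ)

end LongRange

end

open LongRange

universe u

noncomputable section

/-! The time interval is cut into `m` steps of length `Δt` and the radius into `m` shells of width
`δ = R / m`. In each step an operator on a ball of radius `r` evolves for `Δt` and is then truncated
to the ball of radius `r + δ`. The truncation keeps the Pauli products inside a set. It is also an
average of unitary conjugations, so it contracts both the Frobenius and the operator norm
(`opNorm_trunc_le`). The approximants therefore keep operator norm at most one. Evolution does not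
increase the Frobenius norm, so the errors of the steps only add up
(`exists_local_approximation_steps`).

For one step from `X` to `Y ⊇ X`, let `H₀` be the part of `H` that acts off `X` only. It commutes
with the initial operator, so in the interaction picture only `V = H - H₀`, evolved under `H₀`,
moves the operator. The part `trunc Y V` of the generator rotates the component off `Y` without
changing its Frobenius norm. Hence the norm of that component grows at rate at most `2 * frobNorm (V
- trunc Y V)` (`re_inner_leak_le`, `frobNorm_evolve_sub_trunc_le`).

By Parseval, `frobNorm (V - trunc Y V) ^ 2` is a sum of squared Pauli coefficients. It is bounded by
the sum over `i ∈ X`, `j ∉ Y` of the squares of the weights `pairNorm i j V`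
(`frobNorm_sub_trunc_sq_le`). Adding squares is what improves on operator-norm bounds: the exponent
`2α` is summed over pairs and the root is taken afterwards (`sum_ball_far_le`). The weights stay of
order `(d + 1) ^ (-α)` for short times. Indeed `H₀` does not act at `i`, so each commutator either
acts on a Pauli product that already reaches `j` or extends a chain from `i` through `l` to `j`,
which the convolution constant absorbs. The resulting factors `(2G)^n (n+1)!` are summed against
`1/n!` (`pairNorm_evolve_le`).

For constants independent of the system, `λ` and `g` are replaced by values computed from the
parameters, `Δt` is kept between two positive constants, and radii too small for the step count are
covered by the zero operator. The OTOC bound follows because an operator supported away from `i'`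
commutes with `V`. -/

namespace LongRange

open scoped Matrix

set_option linter.unusedSectionVars false

/-! ### Pauli products, the Pauli expansion, and supports. -/

section PauliAlgebra

variable {Λ : Type*} [Fintype Λ] [DecidableEq Λ]

/-- The tensor product of the one-site matrices `M i`. -/
def tensor (M : Λ → Matrix (Fin 2) (Fin 2) ℂ) : Op Λ := fun σ τ => ∏ i, M i (σ i) (τ i)

lemma pauliProd_eq_tensor (p : Λ → Fin 4) : pauliProd p = tensor fun i => pauli (p i) := rfl

lemma tensor_mul (M N : Λ → Matrix (Fin 2) (Fin 2) ℂ) :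
    tensor M * tensor N = tensor fun i => M i * N i := by
  ext σ τ
  simp only [tensor, Matrix.mul_apply, ← Finset.prod_mul_distrib]
  rw [Finset.prod_univ_sum, Fintype.piFinset_univ]

lemma trace_tensor (M : Λ → Matrix (Fin 2) (Fin 2) ℂ) :
    (tensor M).trace = ∏ i, (M i).trace := by
  simp only [Matrix.trace, Matrix.diag, tensor]
  rw [Finset.prod_univ_sum, Fintype.piFinset_univ]

lemma tensor_one : tensor (fun _ : Λ => (1 : Matrix (Fin 2) (Fin 2) ℂ)) = 1 := by
  ext σ τ
  simp only [tensor, Matrix.one_apply, Finset.prod_ite_zero, funext_iff]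
  simp

lemma tensor_smul (z : Λ → ℂ) (M : Λ → Matrix (Fin 2) (Fin 2) ℂ) :
    tensor (fun i => z i • M i) = (∏ i, z i) • tensor M := by
  ext σ τ
  simp [tensor, Finset.prod_mul_distrib]

lemma tensor_conjTranspose (M : Λ → Matrix (Fin 2) (Fin 2) ℂ) :
    (tensor M)ᴴ = tensor fun i => (M i)ᴴ := by
  ext σ τ
  simp [tensor, Matrix.conjTranspose_apply]

lemma sum_tensor_piFinset {κ : Type*} (s : Λ → Finset κ)
    (M : Λ → κ → Matrix (Fin 2) (Fin 2) ℂ) :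
    ∑ q ∈ Fintype.piFinset s, tensor (fun i => M i (q i)) = tensor fun i => ∑ a ∈ s i, M i a := by
  ext σ τ
  simp only [tensor, Matrix.sum_apply]
  rw [Finset.prod_univ_sum]

/-- The label of the product of two Pauli matrices. -/
def pauliMul : Fin 4 → Fin 4 → Fin 4 :=
  ![![0, 1, 2, 3], ![1, 0, 3, 2], ![2, 3, 0, 1], ![3, 2, 1, 0]]

/-- The phase in the product of two Pauli matrices. -/
def pauliPhase : Fin 4 → Fin 4 → ℂ :=
  ![![1, 1, 1, 1], ![1, 1, Complex.I, -Complex.I], ![1, -Complex.I, 1, Complex.I],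
    ![1, Complex.I, -Complex.I, 1]]

lemma pauli_zero : pauli 0 = 1 := rfl

lemma pauli_mul (a b : Fin 4) : pauli a * pauli b = pauliPhase a b • pauli (pauliMul a b) := by
  fin_cases a <;> fin_cases b <;> ext x y <;> fin_cases x <;> fin_cases y <;>
    simp [pauli, pauliPhase, pauliMul, Matrix.mul_apply, Fin.sum_univ_two]

lemma norm_pauliPhase (a b : Fin 4) : ‖pauliPhase a b‖ = 1 := by
  fin_cases a <;> fin_cases b <;> simp [pauliPhase]

lemma pauliMul_zero_left (b : Fin 4) : pauliMul 0 b = b := by revert b; decide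

lemma pauliMul_self (a : Fin 4) : pauliMul a a = 0 := by revert a; decide

lemma pauliMul_eq_zero_iff (a b : Fin 4) : pauliMul a b = 0 ↔ a = b := by
  revert a b; decide

lemma pauliPhase_self (a : Fin 4) : pauliPhase a a = 1 := by
  fin_cases a <;> simp [pauliPhase]

lemma pauli_mul_self (a : Fin 4) : pauli a * pauli a = 1 := by
  rw [pauli_mul, pauliMul_self, pauliPhase_self, one_smul, pauli_zero]

lemma pauli_conjTranspose (a : Fin 4) : (pauli a)ᴴ = pauli a := by
  fin_cases a <;> ext x y <;> fin_cases x <;> fin_cases y <;>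
    simp [pauli, Matrix.conjTranspose_apply]

lemma trace_pauli (a : Fin 4) : (pauli a).trace = if a = 0 then 2 else 0 := by
  fin_cases a <;> simp [pauli, Matrix.trace, Fin.sum_univ_two]

/-- The one-site twirl: two of the four conjugations flip the sign of a nontrivial Pauli matrix, so
the sum vanishes. Averaging over Pauli products thereby removes everything that acts at the site. -/
lemma sum_pauli_conj (a : Fin 4) :
    ∑ b, pauli b * pauli a * pauli b = if a = 0 then (4 : ℂ) • 1 else 0 := by
  fin_cases a <;> ext x y <;> fin_cases x <;> fin_cases y <;>
    simp [pauli, Fin.sum_univ_four] <;> norm_num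

/-- Completeness of the Pauli basis in entries: the sum of `pauli a ⊗ pauli a` is twice the swap.
Its product over all sites gives the Pauli expansion. -/
lemma sum_pauli_entry (x y z w : Fin 2) :
    ∑ a, pauli a z w * pauli a x y = if x = w ∧ y = z then 2 else 0 := by
  fin_cases x <;> fin_cases y <;> fin_cases z <;> fin_cases w <;>
    simp [pauli, Fin.sum_univ_four] <;> norm_num

lemma trace_one_op : (1 : Op Λ).trace = 2 ^ Fintype.card Λ := by
  rw [← tensor_one, trace_tensor]
  simp

/-- The label of the product of two Pauli products. -/
def pauliProdMul (p q : Λ → Fin 4) : Λ → Fin 4 := fun i => pauliMul (p i) (q i)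

lemma pauliProd_mul (p q : Λ → Fin 4) : pauliProd p * pauliProd q =
    (∏ i, pauliPhase (p i) (q i)) • pauliProd (pauliProdMul p q) := by
  simp only [pauliProd_eq_tensor, tensor_mul, pauli_mul, tensor_smul]
  rfl

lemma norm_prod_pauliPhase (p q : Λ → Fin 4) : ‖∏ i, pauliPhase (p i) (q i)‖ = 1 := by
  simp [norm_pauliPhase]

lemma pauliProd_mul_self (p : Λ → Fin 4) : pauliProd p * pauliProd p = 1 := by
  simp only [pauliProd_eq_tensor, tensor_mul, pauli_mul_self, tensor_one]

lemma pauliProd_conjTranspose (p : Λ → Fin 4) : (pauliProd p)ᴴ = pauliProd p := by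
  simp only [pauliProd_eq_tensor, tensor_conjTranspose, pauli_conjTranspose]

/-- Pauli products with disjoint supports commute. -/
lemma pauliProd_commute {p q : Λ → Fin 4} (h : ∀ i, p i = 0 ∨ q i = 0) :
    pauliProd p * pauliProd q = pauliProd q * pauliProd p := by
  simp only [pauliProd_eq_tensor, tensor_mul]
  congr 1
  funext i
  rcases h i with h | h <;> simp [h, pauli_zero]

lemma ntr_pauliProd (p : Λ → Fin 4) : ntr (pauliProd p) = if p = 0 then 1 else 0 := by
  rw [ntr, trace_one_op, pauliProd_eq_tensor, trace_tensor]
  simp only [trace_pauli, Finset.prod_ite_zero]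
  by_cases h : p = 0
  · simp [h]
  · have : ¬ ∀ i, p i = 0 := fun h' => h (funext h')
    simp [h, this]

lemma ntr_add (A B : Op Λ) : ntr (A + B) = ntr A + ntr B := by
  simp [ntr, Matrix.trace_add, add_div]

lemma ntr_smul (z : ℂ) (A : Op Λ) : ntr (z • A) = z * ntr A := by
  simp [ntr, Matrix.trace_smul, mul_div_assoc]

/-- The Pauli coefficient as a linear functional. -/
def pauliCoeffₗ (p : Λ → Fin 4) : Op Λ →ₗ[ℂ] ℂ where
  toFun := pauliCoeff p
  map_add' A B := by simp [pauliCoeff, Matrix.mul_add, ntr_add]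
  map_smul' z A := by simp [pauliCoeff, ntr_smul]

lemma pauliCoeffₗ_apply (p : Λ → Fin 4) (A : Op Λ) : pauliCoeffₗ p A = pauliCoeff p A := rfl

lemma pauliCoeff_add (p : Λ → Fin 4) (A B : Op Λ) :
    pauliCoeff p (A + B) = pauliCoeff p A + pauliCoeff p B := (pauliCoeffₗ p).map_add A B

lemma pauliCoeff_sub (p : Λ → Fin 4) (A B : Op Λ) :
    pauliCoeff p (A - B) = pauliCoeff p A - pauliCoeff p B := (pauliCoeffₗ p).map_sub A B

lemma pauliCoeff_smul (p : Λ → Fin 4) (z : ℂ) (A : Op Λ) :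
    pauliCoeff p (z • A) = z * pauliCoeff p A := (pauliCoeffₗ p).map_smul z A

lemma pauliCoeff_sum {ι : Type*} (p : Λ → Fin 4) (s : Finset ι) (A : ι → Op Λ) :
    pauliCoeff p (∑ j ∈ s, A j) = ∑ j ∈ s, pauliCoeff p (A j) := map_sum (pauliCoeffₗ p) A s

lemma pauliCoeff_zero (p : Λ → Fin 4) : pauliCoeff p (0 : Op Λ) = 0 := (pauliCoeffₗ p).map_zero

lemma pauliCoeff_pauliProd (p q : Λ → Fin 4) :
    pauliCoeff p (pauliProd q) = if p = q then 1 else 0 := by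
  rw [pauliCoeff, pauliProd_mul, ntr_smul, ntr_pauliProd]
  have : pauliProdMul p q = 0 ↔ p = q := by
    simp [funext_iff, pauliProdMul, pauliMul_eq_zero_iff]
  simp only [this]
  split_ifs with h
  · subst h; simp [pauliPhase_self]
  · simp

lemma pauliCoeff_sum_smul (p : Λ → Fin 4) (s : Finset (Λ → Fin 4)) (c : (Λ → Fin 4) → ℂ) :
    pauliCoeff p (∑ q ∈ s, c q • pauliProd q) = if p ∈ s then c p else 0 := by
  simp [pauliCoeff_sum, pauliCoeff_smul, pauliCoeff_pauliProd]

lemma sum_pauliProd_entry (σ τ σ' τ' : Λ → Fin 2) :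
    ∑ p : Λ → Fin 4, pauliProd p σ' τ' * pauliProd p σ τ =
      if σ = τ' ∧ τ = σ' then (2 : ℂ) ^ Fintype.card Λ else 0 := by
  simp only [pauliProd, ← Finset.prod_mul_distrib]
  rw [← Fintype.piFinset_univ,
    ← Finset.prod_univ_sum (fun _ => Finset.univ)
      (fun i a => pauli a (σ' i) (τ' i) * pauli a (σ i) (τ i))]
  simp only [sum_pauli_entry, Finset.prod_ite_zero, funext_iff, forall_and]
  simp

/-- The Pauli expansion of an operator. -/
lemma pauli_expansion (A : Op Λ) : ∑ p, pauliCoeff p A • pauliProd p = A := by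
  ext σ τ
  simp only [Matrix.sum_apply, Matrix.smul_apply, smul_eq_mul, pauliCoeff, ntr, trace_one_op]
  simp only [Matrix.trace, Matrix.diag, Matrix.mul_apply]
  have h2 : (2 : ℂ) ^ Fintype.card Λ ≠ 0 := pow_ne_zero _ two_ne_zero
  calc ∑ p : Λ → Fin 4, (∑ σ', ∑ τ', pauliProd p σ' τ' * A τ' σ') / 2 ^ Fintype.card Λ *
        pauliProd p σ τ
      = ∑ σ', ∑ τ', (∑ p : Λ → Fin 4, pauliProd p σ' τ' * pauliProd p σ τ) *
          A τ' σ' / 2 ^ Fintype.card Λ := by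
        simp only [Finset.sum_div, Finset.sum_mul]
        rw [Finset.sum_comm]
        refine Finset.sum_congr rfl fun σ' _ => ?_
        rw [Finset.sum_comm]
        refine Finset.sum_congr rfl fun τ' _ => Finset.sum_congr rfl fun p _ => ?_
        ring
    _ = A σ τ := by
        simp only [sum_pauliProd_entry]
        rw [Finset.sum_eq_single τ, Finset.sum_eq_single σ]
        · simp [h2]
        · intro b _ hb; simp [hb.symm]
        · simp
        · intro b _ hb; simp [hb.symm]
        · simp

lemma pauliCoeff_ext {A B : Op Λ} (h : ∀ p, pauliCoeff p A = pauliCoeff p B) : A = B := by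
  rw [← pauli_expansion A, ← pauli_expansion B]
  simp [h]

lemma pauliCoeff_conjTranspose (p : Λ → Fin 4) (A : Op Λ) :
    pauliCoeff p Aᴴ = star (pauliCoeff p A) := by
  conv_lhs => rw [← pauli_expansion A]
  simp only [Matrix.conjTranspose_sum, Matrix.conjTranspose_smul, pauliProd_conjTranspose]
  rw [pauliCoeff_sum_smul p Finset.univ (fun q => star (pauliCoeff q A))]
  simp

/-- The support of a Pauli product. -/
def psupp (p : Λ → Fin 4) : Finset Λ := Finset.univ.filter fun i => p i ≠ 0

lemma mem_psupp {p : Λ → Fin 4} {i : Λ} : i ∈ psupp p ↔ p i ≠ 0 := by simp [psupp]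

/-- A Pauli label on `X`, extended by the identity. -/
def extendLabel (X : Finset Λ) (q : X → Fin 4) : Λ → Fin 4 :=
  fun i => if h : i ∈ X then q ⟨i, h⟩ else 0

lemma pauliProd_extendLabel (X : Finset Λ) (q : X → Fin 4) (σ τ : Λ → Fin 2) :
    pauliProd (extendLabel X q) σ τ =
      if ∀ i, i ∉ X → σ i = τ i then pauliProd q (fun i => σ i) (fun i => τ i) else 0 := by
  have h1 : ∏ i ∈ X, pauli (extendLabel X q i) (σ i) (τ i) =
      pauliProd q (fun i => σ i) (fun i => τ i) := by
    rw [pauliProd, ← Finset.prod_coe_sort]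
    refine Finset.prod_congr rfl fun i _ => ?_
    simp [extendLabel]
  have h2 : ∏ i ∈ Xᶜ, pauli (extendLabel X q i) (σ i) (τ i) =
      if ∀ i, i ∉ X → σ i = τ i then 1 else 0 := by
    have : ∀ i ∈ Xᶜ, pauli (extendLabel X q i) (σ i) (τ i) = if σ i = τ i then 1 else 0 := by
      intro i hi
      rw [Finset.mem_compl] at hi
      simp [extendLabel, hi, pauli_zero, Matrix.one_apply]
    rw [Finset.prod_congr rfl this, Finset.prod_ite_zero]
    simp
  rw [pauliProd, ← Finset.prod_mul_prod_compl X, h1, h2]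
  split_ifs <;> simp

/-- An operator acts on `X` only iff its Pauli expansion does. -/
lemma supportedOn_iff (X : Finset Λ) (A : Op Λ) :
    SupportedOn X A ↔ ∀ p, ¬ psupp p ⊆ X → pauliCoeff p A = 0 := by
  constructor
  · rintro ⟨B, hB⟩ p hp
    have hA : A = ∑ q : X → Fin 4, pauliCoeff q B • pauliProd (extendLabel X q) := by
      ext σ τ
      rw [hB, Matrix.sum_apply]
      simp only [Matrix.smul_apply, pauliProd_extendLabel]
      split_ifs with h
      · conv_lhs => rw [← pauli_expansion B]
        simp [Matrix.sum_apply]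
      · simp
    rw [hA, pauliCoeff_sum]
    refine Finset.sum_eq_zero fun q _ => ?_
    rw [pauliCoeff_smul, pauliCoeff_pauliProd, if_neg, mul_zero]
    rintro rfl
    refine hp fun i hi => ?_
    by_contra h
    exact mem_psupp.1 hi (by simp [extendLabel, h])
  · intro h
    refine ⟨∑ p ∈ Finset.univ.filter (fun p => psupp p ⊆ X),
      pauliCoeff p A • pauliProd (fun i : X => p i), fun σ τ => ?_⟩
    have hp : ∀ p ∈ Finset.univ.filter (fun p => psupp p ⊆ X), pauliProd p σ τ =
        if ∀ i, i ∉ X → σ i = τ i then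
          pauliProd (fun i : X => p i) (fun i => σ i) (fun i => τ i) else 0 := by
      intro p hp
      rw [← pauliProd_extendLabel]
      congr 1
      funext i
      by_cases hi : i ∈ X
      · simp [extendLabel, hi]
      · have := fun h' => hi ((Finset.mem_filter.1 hp).2 (mem_psupp.2 h'))
        simpa [extendLabel, hi] using this
    conv_lhs => rw [← pauli_expansion A]
    rw [← Finset.sum_filter_add_sum_filter_not Finset.univ (fun p => psupp p ⊆ X)]
    rw [Finset.sum_eq_zero (s := Finset.univ.filter (fun p => ¬ psupp p ⊆ X)), add_zero]
    · simp only [Matrix.sum_apply, Matrix.smul_apply]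
      rw [Finset.sum_congr rfl fun p h' => by rw [hp p h']]
      split_ifs <;> simp
    · intro p h'
      rw [h p (Finset.mem_filter.1 h').2, zero_smul]

lemma SupportedOn.mono {X Y : Finset Λ} {A : Op Λ} (h : SupportedOn X A) (hXY : X ⊆ Y) :
    SupportedOn Y A := by
  rw [supportedOn_iff] at *
  exact fun p hp => h p fun h' => hp (h'.trans hXY)

lemma SupportedOn.zero (X : Finset Λ) : SupportedOn X (0 : Op Λ) := by
  rw [supportedOn_iff]
  exact fun p _ => pauliCoeff_zero p

/-- Operators on disjoint sets of sites commute. -/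
lemma SupportedOn.commute {X Y : Finset Λ} {A B : Op Λ} (hA : SupportedOn X A)
    (hB : SupportedOn Y B) (hXY : Disjoint X Y) : A * B = B * A := by
  rw [supportedOn_iff] at hA hB
  rw [← pauli_expansion A, ← pauli_expansion B]
  simp only [Finset.sum_mul, Finset.mul_sum]
  rw [Finset.sum_comm]
  refine Finset.sum_congr rfl fun p _ => Finset.sum_congr rfl fun q _ => ?_
  by_cases hp : psupp p ⊆ X
  · by_cases hq : psupp q ⊆ Y
    · rw [smul_mul_smul_comm, smul_mul_smul_comm, mul_comm (pauliCoeff p A), pauliProd_commute]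
      intro i
      by_contra! h
      exact Finset.disjoint_left.1 hXY (hp (mem_psupp.2 h.1)) (hq (mem_psupp.2 h.2))
    · simp [hB q hq]
  · simp [hA p hp]

lemma supportedOn_pauliProd {X : Finset Λ} {p : Λ → Fin 4} (h : psupp p ⊆ X) :
    SupportedOn X (pauliProd p) := by
  rw [supportedOn_iff]
  intro q hq
  rw [pauliCoeff_pauliProd, if_neg]
  rintro rfl
  exact hq h

end PauliAlgebra

/-! ### Parseval, the Frobenius and operator norms, and unitary evolution. -/

section Norms

variable {Λ : Type*} [Fintype Λ] [DecidableEq Λ]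

lemma ntr_conjTranspose_mul_self (A : Op Λ) :
    ntr (Aᴴ * A) = ((∑ p, ‖pauliCoeff p A‖ ^ 2 : ℝ) : ℂ) := by
  have h : Aᴴ = ∑ p, star (pauliCoeff p A) • pauliProd p := by
    conv_lhs => rw [← pauli_expansion A]
    simp only [Matrix.conjTranspose_sum, Matrix.conjTranspose_smul, pauliProd_conjTranspose]
  have hs : ∀ (s : Finset (Λ → Fin 4)) (f : (Λ → Fin 4) → Op Λ),
      ntr (∑ p ∈ s, f p) = ∑ p ∈ s, ntr (f p) := by
    intro s f
    simp [ntr, Matrix.trace_sum, Finset.sum_div]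
  rw [h, Finset.sum_mul, hs]
  push_cast
  refine Finset.sum_congr rfl fun p _ => ?_
  rw [Matrix.smul_mul, ntr_smul, ← pauliCoeff, ← Complex.conj_mul']
  rfl

/-- Parseval's identity for the Pauli expansion. -/
lemma frobNorm_sq (A : Op Λ) : frobNorm A ^ 2 = ∑ p, ‖pauliCoeff p A‖ ^ 2 := by
  rw [frobNorm, ntr_conjTranspose_mul_self, Complex.ofReal_re, Real.sq_sqrt]
  positivity

/-- The vector of the Pauli coefficients. -/
def pauliVec : Op Λ →ₗ[ℂ] EuclideanSpace ℂ (Λ → Fin 4) where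
  toFun A := WithLp.toLp 2 fun p => pauliCoeff p A
  map_add' A B := by ext p; simp [pauliCoeff_add]
  map_smul' z A := by ext p; simp [pauliCoeff_smul]

lemma pauliVec_apply (A : Op Λ) (p : Λ → Fin 4) : pauliVec A p = pauliCoeff p A := rfl

lemma frobNorm_eq_norm (A : Op Λ) : frobNorm A = ‖pauliVec A‖ := by
  rw [EuclideanSpace.norm_eq, frobNorm, ntr_conjTranspose_mul_self, Complex.ofReal_re]
  rfl

lemma frobNorm_nonneg (A : Op Λ) : 0 ≤ frobNorm A := Real.sqrt_nonneg _

lemma frobNorm_add_le (A B : Op Λ) : frobNorm (A + B) ≤ frobNorm A + frobNorm B := by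
  simp only [frobNorm_eq_norm, map_add]
  exact norm_add_le _ _

lemma frobNorm_sub_le (A B : Op Λ) : frobNorm (A - B) ≤ frobNorm A + frobNorm B := by
  simp only [frobNorm_eq_norm, map_sub]
  exact norm_sub_le _ _

lemma frobNorm_zero : frobNorm (0 : Op Λ) = 0 := by
  simp [frobNorm_eq_norm]

lemma frobNorm_sq_entries (A : Op Λ) :
    frobNorm A ^ 2 = (∑ τ, ∑ σ, ‖A σ τ‖ ^ 2) / 2 ^ Fintype.card Λ := by
  have h : ntr (Aᴴ * A) = (((∑ τ, ∑ σ, ‖A σ τ‖ ^ 2) / 2 ^ Fintype.card Λ : ℝ) : ℂ) := by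
    rw [ntr, trace_one_op]
    simp only [Matrix.trace, Matrix.diag, Matrix.mul_apply, Matrix.conjTranspose_apply]
    push_cast
    congr 1
    refine Finset.sum_congr rfl fun τ _ => Finset.sum_congr rfl fun σ _ => ?_
    rw [← Complex.conj_mul']
    rfl
  rw [frobNorm, h, Complex.ofReal_re, Real.sq_sqrt]
  positivity

lemma frobNorm_conjTranspose (A : Op Λ) : frobNorm Aᴴ = frobNorm A := by
  rw [← sq_eq_sq₀ (frobNorm_nonneg _) (frobNorm_nonneg _), frobNorm_sq_entries,
    frobNorm_sq_entries, Finset.sum_comm]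
  simp [Matrix.conjTranspose_apply]

section L2

open scoped Matrix.Norms.L2Operator

lemma opNorm_eq_norm (A : Op Λ) : opNorm A = ‖A‖ := rfl

lemma frobNorm_mul_le (A B : Op Λ) : frobNorm (A * B) ≤ opNorm A * frobNorm B := by
  have h0 : 0 ≤ opNorm A := norm_nonneg _
  rw [← sq_le_sq₀ (frobNorm_nonneg _) (mul_nonneg h0 (frobNorm_nonneg _)), mul_pow,
    frobNorm_sq_entries, frobNorm_sq_entries, mul_div_assoc', Finset.mul_sum]
  gcongr with τ _
  -- The squared Frobenius norm is a sum over columns, and `A` acts on each column of `B`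
  -- separately.
  have h := Matrix.l2_opNorm_mulVec A (WithLp.toLp 2 fun σ => B σ τ)
  have h' := pow_le_pow_left₀ (norm_nonneg _) h 2
  rw [mul_pow, EuclideanSpace.norm_sq_eq, EuclideanSpace.norm_sq_eq] at h'
  exact h'

lemma frobNorm_mul_le' (A B : Op Λ) : frobNorm (A * B) ≤ frobNorm A * opNorm B := by
  rw [← frobNorm_conjTranspose, Matrix.conjTranspose_mul]
  refine (frobNorm_mul_le _ _).trans ?_
  rw [frobNorm_conjTranspose, opNorm_eq_norm, Matrix.l2_opNorm_conjTranspose, mul_comm]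
  rfl

lemma opNorm_one_le : opNorm (1 : Op Λ) ≤ 1 := by
  rw [opNorm_eq_norm]; exact (norm_one (α := Op Λ)).le

lemma frobNorm_le_opNorm (A : Op Λ) : frobNorm A ≤ opNorm A := by
  have h : frobNorm (1 : Op Λ) = 1 := by
    have h2 : (2 : ℂ) ^ Fintype.card Λ ≠ 0 := pow_ne_zero _ two_ne_zero
    simp [frobNorm, ntr, h2]
  have := frobNorm_mul_le A 1
  rwa [mul_one, h, mul_one] at this

/-- The commutator in Frobenius norm. -/
lemma frobNorm_commutator_le (A B : Op Λ) :
    frobNorm (A * B - B * A) ≤ 2 * frobNorm A * opNorm B := by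
  have h1 := frobNorm_sub_le (A * B) (B * A)
  have h2 := frobNorm_mul_le' A B
  have h3 := frobNorm_mul_le B A
  linarith

lemma opNorm_mul_le (A B : Op Λ) : opNorm (A * B) ≤ opNorm A * opNorm B := by
  simp only [opNorm_eq_norm]
  exact norm_mul_le A B

lemma opNorm_le_one_of_unitary {U : Op Λ} (h : Uᴴ * U = 1) : opNorm U ≤ 1 := by
  have h1 := Matrix.l2_opNorm_conjTranspose_mul_self U
  rw [h] at h1
  have h2 : ‖(1 : Op Λ)‖ ≤ 1 := opNorm_one_le
  rw [opNorm_eq_norm]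
  nlinarith [norm_nonneg U]

lemma opNorm_pauliProd_le (p : Λ → Fin 4) : opNorm (pauliProd p) ≤ 1 :=
  opNorm_le_one_of_unitary (by rw [pauliProd_conjTranspose, pauliProd_mul_self])

end L2

lemma conjTranspose_exp_I (H : Op Λ) (hH : H.IsHermitian) (t : ℝ) :
    (NormedSpace.exp ((Complex.I * (t : ℂ)) • H))ᴴ =
      NormedSpace.exp ((-(Complex.I * (t : ℂ))) • H) := by
  rw [← Matrix.exp_conjTranspose, Matrix.conjTranspose_smul, hH.eq]
  simp

lemma exp_smul_mul_exp_neg_smul (H : Op Λ) (z : ℂ) :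
    NormedSpace.exp (z • H) * NormedSpace.exp ((-z) • H) = 1 := by
  rw [← Matrix.exp_add_of_commute]
  · simp
  · exact (Commute.refl H).smul_left _ |>.smul_right _

lemma opNorm_exp_le (H : Op Λ) (hH : H.IsHermitian) (t : ℝ) :
    opNorm (NormedSpace.exp ((Complex.I * (t : ℂ)) • H)) ≤ 1 := by
  refine opNorm_le_one_of_unitary ?_
  rw [conjTranspose_exp_I H hH]
  simpa using exp_smul_mul_exp_neg_smul H (-(Complex.I * (t : ℂ)))

lemma opNorm_exp_neg_le (H : Op Λ) (hH : H.IsHermitian) (t : ℝ) :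
    opNorm (NormedSpace.exp ((-(Complex.I * (t : ℂ))) • H)) ≤ 1 := by
  have := opNorm_exp_le H hH (-t)
  simpa using this

lemma opNorm_nonneg (A : Op Λ) : 0 ≤ opNorm A := norm_nonneg _

lemma opNorm_evolve_le (H : Op Λ) (hH : H.IsHermitian) (t : ℝ) (W : Op Λ) :
    opNorm (evolve H t W) ≤ opNorm W := by
  have h1 := opNorm_exp_le H hH t
  have h2 := opNorm_exp_neg_le H hH t
  rw [evolve]
  refine (opNorm_mul_le _ _).trans ?_
  refine (mul_le_of_le_one_right (opNorm_nonneg _) h2).trans ?_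
  refine (opNorm_mul_le _ _).trans ?_
  exact mul_le_of_le_one_left (opNorm_nonneg _) h1

lemma frobNorm_evolve_le (H : Op Λ) (hH : H.IsHermitian) (t : ℝ) (W : Op Λ) :
    frobNorm (evolve H t W) ≤ frobNorm W := by
  have h1 := opNorm_exp_le H hH t
  have h2 := opNorm_exp_neg_le H hH t
  rw [evolve]
  refine (frobNorm_mul_le' _ _).trans ?_
  refine (mul_le_of_le_one_right (frobNorm_nonneg _) h2).trans ?_
  refine (frobNorm_mul_le _ _).trans ?_
  exact mul_le_of_le_one_left (frobNorm_nonneg _) h1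

lemma evolve_sub (H : Op Λ) (t : ℝ) (A B : Op Λ) :
    evolve H t (A - B) = evolve H t A - evolve H t B := by
  simp [evolve, mul_sub, sub_mul]

lemma evolve_add_time (H : Op Λ) (s t : ℝ) (A : Op Λ) :
    evolve H (s + t) A = evolve H s (evolve H t A) := by
  have hc : ∀ z w : ℂ, Commute (z • H) (w • H) := fun z w =>
    (Commute.refl H).smul_left _ |>.smul_right _
  have h1 : (Complex.I * ((s + t : ℝ) : ℂ)) • H =
      (Complex.I * (s : ℂ)) • H + (Complex.I * (t : ℂ)) • H := by
    rw [← add_smul]; push_cast; ring_nf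
  have h2 : (-(Complex.I * ((s + t : ℝ) : ℂ))) • H =
      (-(Complex.I * (t : ℂ))) • H + (-(Complex.I * (s : ℂ))) • H := by
    rw [← add_smul]; push_cast; ring_nf
  simp only [evolve, h1, h2, Matrix.exp_add_of_commute _ _ (hc _ _), mul_assoc]

lemma evolve_zero_time (H A : Op Λ) : evolve H 0 A = A := by
  simp [evolve]

end Norms

/-! ### Truncation to a set of sites as a conditional expectation. -/

section Truncation

variable {Λ : Type*} [Fintype Λ] [DecidableEq Λ]

/-- The part of `A` that acts on `Y` only. -/
def trunc (Y : Finset Λ) : Op Λ →ₗ[ℂ] Op Λ where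
  toFun A := ∑ p ∈ Finset.univ.filter (fun p => psupp p ⊆ Y), pauliCoeff p A • pauliProd p
  map_add' A B := by simp [pauliCoeff_add, add_smul, Finset.sum_add_distrib]
  map_smul' z A := by simp [pauliCoeff_smul, mul_smul, Finset.smul_sum]

lemma trunc_apply (Y : Finset Λ) (A : Op Λ) : trunc Y A =
    ∑ p ∈ Finset.univ.filter (fun p => psupp p ⊆ Y), pauliCoeff p A • pauliProd p := rfl

lemma pauliCoeff_trunc (Y : Finset Λ) (A : Op Λ) (p : Λ → Fin 4) :
    pauliCoeff p (trunc Y A) = if psupp p ⊆ Y then pauliCoeff p A else 0 := by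
  rw [trunc_apply, pauliCoeff_sum_smul p _ (fun q => pauliCoeff q A)]
  simp

lemma supportedOn_trunc (Y : Finset Λ) (A : Op Λ) : SupportedOn Y (trunc Y A) := by
  rw [supportedOn_iff]
  intro p hp
  rw [pauliCoeff_trunc, if_neg hp]

lemma trunc_eq_self {Y : Finset Λ} {A : Op Λ} (h : SupportedOn Y A) : trunc Y A = A := by
  rw [supportedOn_iff] at h
  refine pauliCoeff_ext fun p => ?_
  rw [pauliCoeff_trunc]
  split_ifs with hp
  · rfl
  · exact (h p hp).symm

/-- The labels of the Pauli products that act off `Y` only. -/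
def labelsOff (Y : Finset Λ) : Finset (Λ → Fin 4) :=
  Fintype.piFinset fun i => if i ∈ Y then {0} else Finset.univ

lemma psupp_subset_of_mem_labelsOff {Y : Finset Λ} {q : Λ → Fin 4} (hq : q ∈ labelsOff Y) :
    psupp q ⊆ Yᶜ := by
  intro i hi
  rw [Finset.mem_compl]
  intro hY
  have := Fintype.mem_piFinset.1 hq i
  rw [if_pos hY, Finset.mem_singleton] at this
  exact mem_psupp.1 hi this

/-- The sum factorizes over the sites. At a site of `Y` only the identity conjugates; elsewhere the
full twirl annihilates every nontrivial Pauli matrix. -/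
lemma sum_labelsOff_conj_pauliProd (Y : Finset Λ) (p : Λ → Fin 4) :
    ∑ q ∈ labelsOff Y, pauliProd q * pauliProd p * pauliProd q =
      ((labelsOff Y).card : ℂ) • if psupp p ⊆ Y then pauliProd p else 0 := by
  simp only [pauliProd_eq_tensor, tensor_mul, labelsOff]
  rw [sum_tensor_piFinset (fun i => if i ∈ Y then {0} else Finset.univ)
    (fun i a => pauli a * pauli (p i) * pauli a)]
  have h : ∀ i, ∑ a ∈ (if i ∈ Y then {0} else Finset.univ), pauli a * pauli (p i) * pauli a =
      ((if i ∈ Y then ({0} : Finset (Fin 4)) else Finset.univ).card : ℂ) •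
        if p i ≠ 0 → i ∈ Y then pauli (p i) else 0 := by
    intro i
    by_cases hi : i ∈ Y
    · simp [hi, pauli_zero]
    · by_cases hp : p i = 0
      · simp only [if_neg hi, sum_pauli_conj, hp]
        simp [pauli_zero]
      · simp [hi, hp, sum_pauli_conj]
  simp only [h]
  rw [tensor_smul, Fintype.card_piFinset]
  push_cast
  congr 1
  split_ifs with hs
  · congr 1
    funext i
    rw [if_pos]
    exact fun h' => hs (mem_psupp.2 h')
  · obtain ⟨i, hi, hiY⟩ := Finset.not_subset.1 hs
    ext σ τ
    rw [tensor, Finset.prod_eq_zero (Finset.mem_univ i)]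
    · simp
    · rw [if_neg]
      · simp
      · exact fun h' => hiY (h' (mem_psupp.1 hi))

lemma card_labelsOff_pos (Y : Finset Λ) : 0 < (labelsOff Y).card := by
  refine Finset.card_pos.2 ⟨0, Fintype.mem_piFinset.2 fun i => ?_⟩
  split_ifs <;> simp

/-- The truncation as an average over the Pauli products off `Y`. -/
lemma card_smul_trunc (Y : Finset Λ) (A : Op Λ) : ((labelsOff Y).card : ℂ) • trunc Y A =
    ∑ q ∈ labelsOff Y, pauliProd q * A * pauliProd q := by
  conv_rhs => rw [← pauli_expansion A]
  simp only [Finset.mul_sum, Finset.sum_mul]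
  rw [Finset.sum_comm]
  simp only [Matrix.mul_smul, Matrix.smul_mul, ← Finset.smul_sum, sum_labelsOff_conj_pauliProd]
  rw [trunc_apply, Finset.sum_filter, Finset.smul_sum]
  refine Finset.sum_congr rfl fun p _ => ?_
  split_ifs
  · rw [smul_comm]
  · simp

/-- An average of unitary conjugates has no larger operator norm. This allows the one-step bound,
which needs operator norm at most one, to be iterated. -/
lemma opNorm_trunc_le (Y : Finset Λ) (A : Op Λ) : opNorm (trunc Y A) ≤ opNorm A := by
  have hc : (0 : ℝ) < (labelsOff Y).card := by exact_mod_cast card_labelsOff_pos Y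
  have h : opNorm (((labelsOff Y).card : ℂ) • trunc Y A) ≤ (labelsOff Y).card * opNorm A := by
    rw [card_smul_trunc, opNorm, map_sum]
    refine (norm_sum_le _ _).trans ?_
    rw [← nsmul_eq_mul]
    refine Finset.sum_le_card_nsmul _ _ _ fun q _ => ?_
    change opNorm _ ≤ _
    have hq := opNorm_pauliProd_le q
    refine (opNorm_mul_le _ _).trans ?_
    refine (mul_le_of_le_one_right (opNorm_nonneg _) hq).trans ?_
    refine (opNorm_mul_le _ _).trans ?_
    exact mul_le_of_le_one_left (opNorm_nonneg _) hq
  rw [opNorm, map_smul, norm_smul, Complex.norm_natCast] at h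
  exact le_of_mul_le_mul_left h hc

/-- The bimodule property of a conditional expectation: `B` commutes with the Pauli products over
which the truncation averages. -/
lemma trunc_mul_left {Y : Finset Λ} {B : Op Λ} (hB : SupportedOn Y B) (A : Op Λ) :
    trunc Y (B * A) = B * trunc Y A := by
  have hc : ((labelsOff Y).card : ℂ) ≠ 0 := by exact_mod_cast (card_labelsOff_pos Y).ne'
  refine smul_right_injective _ hc ?_
  simp only
  rw [card_smul_trunc, ← Matrix.mul_smul, card_smul_trunc, Finset.mul_sum]
  refine Finset.sum_congr rfl fun q hq => ?_
  rw [← mul_assoc, ← mul_assoc, ← mul_assoc, hB.commute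
    (supportedOn_pauliProd (psupp_subset_of_mem_labelsOff hq)) disjoint_compl_right]

lemma trunc_mul_right {Y : Finset Λ} {B : Op Λ} (hB : SupportedOn Y B) (A : Op Λ) :
    trunc Y (A * B) = trunc Y A * B := by
  have hc : ((labelsOff Y).card : ℂ) ≠ 0 := by exact_mod_cast (card_labelsOff_pos Y).ne'
  refine smul_right_injective _ hc ?_
  simp only
  rw [card_smul_trunc, ← Matrix.smul_mul, card_smul_trunc, Finset.sum_mul]
  refine Finset.sum_congr rfl fun q hq => ?_
  simp only [mul_assoc]
  rw [hB.commute (supportedOn_pauliProd (psupp_subset_of_mem_labelsOff hq)) disjoint_compl_right]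

lemma frobNorm_sub_trunc_sq (Y : Finset Λ) (A : Op Λ) : frobNorm (A - trunc Y A) ^ 2 =
    ∑ p ∈ Finset.univ.filter (fun p => ¬ psupp p ⊆ Y), ‖pauliCoeff p A‖ ^ 2 := by
  rw [frobNorm_sq, Finset.sum_filter]
  refine Finset.sum_congr rfl fun p _ => ?_
  rw [pauliCoeff_sub, pauliCoeff_trunc]
  by_cases h : psupp p ⊆ Y <;> simp [h]

lemma frobNorm_sub_trunc_le (Y : Finset Λ) (A : Op Λ) : frobNorm (A - trunc Y A) ≤ frobNorm A := by
  rw [← sq_le_sq₀ (frobNorm_nonneg _) (frobNorm_nonneg _), frobNorm_sub_trunc_sq, frobNorm_sq]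
  exact Finset.sum_le_sum_of_subset_of_nonneg (Finset.filter_subset _ _) fun _ _ _ => by positivity

end Truncation

/-! ### Conjugation by exponentials and nested commutators in a Banach algebra. -/

section BanachAlgebra

variable {𝔸 : Type*} [NormedRing 𝔸] [NormedAlgebra ℂ 𝔸] [CompleteSpace 𝔸]

lemma hasDerivAt_exp_neg_smul (H : 𝔸) (z : ℂ) :
    HasDerivAt (fun u : ℂ => NormedSpace.exp ((-u) • H)) (-(NormedSpace.exp ((-z) • H) * H)) z := by
  have h := (hasDerivAt_exp_smul_const H (-z)).scomp z (hasDerivAt_neg z)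
  rw [neg_one_smul] at h
  exact h

lemma hasDerivAt_conj_exp (H W : 𝔸) (z : ℂ) :
    HasDerivAt (fun u : ℂ => NormedSpace.exp (u • H) * W * NormedSpace.exp ((-u) • H))
      (H * (NormedSpace.exp (z • H) * W * NormedSpace.exp ((-z) • H)) -
        NormedSpace.exp (z • H) * W * NormedSpace.exp ((-z) • H) * H) z := by
  have h := ((hasDerivAt_exp_smul_const' H z).mul_const W).mul (hasDerivAt_exp_neg_smul H z)
  convert! h using 1
  noncomm_ring

lemma exp_smul_mul_exp_neg (L : 𝔸) (z : ℂ) :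
    NormedSpace.exp (z • L) * NormedSpace.exp ((-z) • L) = 1 := by
  let _ : NormedAlgebra ℚ 𝔸 := NormedAlgebra.restrictScalars ℚ ℂ 𝔸
  rw [← NormedSpace.exp_add_of_commute]
  · simp
  · exact (Commute.refl _).smul_left _ |>.smul_right _

lemma exp_neg_zero_smul (L : 𝔸) : NormedSpace.exp ((-0 : ℂ) • L) = 1 := by simp

lemma hasSum_exp_smul (L : 𝔸) (z : ℂ) :
    HasSum (fun n : ℕ => ((n.factorial : ℂ)⁻¹ * z ^ n) • L ^ n) (NormedSpace.exp (z • L)) := by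
  have h := NormedSpace.exp_series_hasSum_exp' (𝕂 := ℂ) (z • L)
  simpa only [smul_pow, smul_smul] using h

/-- The commutator with `H` as a continuous linear map. -/
def adCLM (H : 𝔸) : 𝔸 →L[ℂ] 𝔸 :=
  ContinuousLinearMap.mul ℂ 𝔸 H - (ContinuousLinearMap.mul ℂ 𝔸).flip H

lemma adCLM_apply (H A : 𝔸) : adCLM H A = H * A - A * H := rfl

lemma conj_exp_eq_exp_adCLM (H W : 𝔸) (z : ℂ) :
    NormedSpace.exp (z • H) * W * NormedSpace.exp ((-z) • H) =
      NormedSpace.exp (z • adCLM H) W := by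
  -- Undoing the conjugation with the exponential of `-u • adCLM H` gives a constant function of
  -- `u`, with value `W` at zero.
  have hd : ∀ u : ℂ, HasDerivAt (fun u : ℂ => NormedSpace.exp ((-u) • adCLM H)
      (NormedSpace.exp (u • H) * W * NormedSpace.exp ((-u) • H))) 0 u := by
    intro u
    have h2 := (hasDerivAt_exp_neg_smul (adCLM H) u).clm_apply (hasDerivAt_conj_exp H W u)
    convert! h2 using 1
    rw [neg_apply, mul_apply_eq_comp, adCLM_apply, neg_add_cancel]
  have hc := is_const_of_deriv_eq_zero (fun u => (hd u).differentiableAt) (fun u => (hd u).deriv)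
    z 0
  rw [exp_neg_zero_smul (adCLM H)] at hc
  simp only [neg_zero, zero_smul, NormedSpace.exp_zero, one_mul, mul_one] at hc
  have h4 := congrArg (fun x => NormedSpace.exp (z • adCLM H) x) hc
  simp only [← mul_apply_eq_comp] at h4
  rw [exp_smul_mul_exp_neg (adCLM H) z] at h4
  simpa using h4

/-- The expansion of `e^{zH} W e^{-zH}` in nested commutators. -/
lemma hasSum_conj_exp (H W : 𝔸) (z : ℂ) :
    HasSum (fun n : ℕ => ((n.factorial : ℂ)⁻¹ * z ^ n) • ((fun A => H * A - A * H)^[n] W))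
      (NormedSpace.exp (z • H) * W * NormedSpace.exp ((-z) • H)) := by
  rw [conj_exp_eq_exp_adCLM]
  have h := hasSum_exp_smul (adCLM H) z
  have h2 := h.mapL (ContinuousLinearMap.apply ℂ 𝔸 W)
  have h3 : ∀ n, (adCLM H ^ n) W = (fun A => H * A - A * H)^[n] W := by
    intro n
    induction n with
    | zero => simp
    | succ n ih => rw [pow_succ', mul_apply_eq_comp, ih, Function.iterate_succ_apply',
        adCLM_apply]
  convert! h2 using 2 with n
  rw [← h3]
  rfl

end BanachAlgebra

/-! ### Supports of exponentials and the commutator series of the evolution. -/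

section Exponential

variable {Λ : Type*} [Fintype Λ] [DecidableEq Λ]

/-- If `A` commutes with all Pauli products off `Y`, averaging over them fixes it. Locality thus
becomes a commutant condition, which exponentials inherit. -/
lemma supportedOn_iff_commute (Y : Finset Λ) (A : Op Λ) :
    SupportedOn Y A ↔ ∀ q ∈ labelsOff Y, Commute (pauliProd q) A := by
  constructor
  · intro h q hq
    exact (h.commute (supportedOn_pauliProd (psupp_subset_of_mem_labelsOff hq))
      disjoint_compl_right).symm
  · intro h
    have hc : ((labelsOff Y).card : ℂ) ≠ 0 := by exact_mod_cast (card_labelsOff_pos Y).ne'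
    have h1 : trunc Y A = A := by
      refine smul_right_injective _ hc ?_
      simp only
      rw [card_smul_trunc]
      have : ∀ q ∈ labelsOff Y, pauliProd q * A * pauliProd q = A := by
        intro q hq
        rw [(h q hq).eq, mul_assoc, pauliProd_mul_self, mul_one]
      rw [Finset.sum_congr rfl this, Finset.sum_const, Nat.cast_smul_eq_nsmul]
    rw [← h1]
    exact supportedOn_trunc Y A

open scoped Matrix.Norms.L2Operator in
lemma SupportedOn.exp {Y : Finset Λ} {A : Op Λ} (h : SupportedOn Y A) (z : ℂ) :
    SupportedOn Y (NormedSpace.exp (z • A)) := by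
  rw [supportedOn_iff_commute] at *
  exact fun q hq => ((h q hq).smul_right z).exp_right

lemma trunc_evolve {Y : Finset Λ} {H : Op Λ} (hH : SupportedOn Y H) (t : ℝ) (A : Op Λ) :
    trunc Y (evolve H t A) = evolve H t (trunc Y A) := by
  rw [evolve, evolve, trunc_mul_right (hH.exp _), trunc_mul_left (hH.exp _)]

/-- The commutator with `H`. -/
def adOp (H : Op Λ) : Op Λ →ₗ[ℂ] Op Λ := LinearMap.mulLeft ℂ H - LinearMap.mulRight ℂ H

lemma adOp_apply (H A : Op Λ) : adOp H A = H * A - A * H := rfl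

section L2

open scoped Matrix.Norms.L2Operator

lemma continuous_pauliCoeff (p : Λ → Fin 4) : Continuous (pauliCoeff p : Op Λ → ℂ) :=
  (pauliCoeffₗ p).continuous_of_finiteDimensional

lemma hasSum_evolve (H W : Op Λ) (t : ℝ) :
    HasSum (fun n : ℕ => ((n.factorial : ℂ)⁻¹ * (Complex.I * t) ^ n) • ((adOp H)^[n] W))
      (evolve H t W) :=
  hasSum_conj_exp H W _

end L2

end Exponential

/-! ### Growth of pair weights under nested commutators. -/

section Growth

variable {Λ : Type*} [Fintype Λ] [DecidableEq Λ]

/-- `1` if the Pauli product `q` acts at `i`, and `0` otherwise. -/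
def act (q : Λ → Fin 4) (i : Λ) : ℝ := if q i = 0 then 0 else 1

lemma act_nonneg (q : Λ → Fin 4) (i : Λ) : 0 ≤ act q i := by
  unfold act; split_ifs <;> norm_num

lemma act_of_ne {q : Λ → Fin 4} {i : Λ} (h : q i ≠ 0) : act q i = 1 := if_neg h

lemma sum_act (q : Λ → Fin 4) : ∑ i, act q i = (psupp q).card := by
  rw [psupp, Finset.card_filter]
  push_cast
  refine Finset.sum_congr rfl fun i _ => ?_
  unfold act
  split_ifs <;> simp_all

/-- The total weight of the Pauli products in `A` that act both at `i` and at `j`. -/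
def pairNorm (i j : Λ) (A : Op Λ) : ℝ := ∑ q, ‖pauliCoeff q A‖ * (act q i * act q j)

lemma pairNorm_nonneg (i j : Λ) (A : Op Λ) : 0 ≤ pairNorm i j A :=
  Finset.sum_nonneg fun q _ => mul_nonneg (norm_nonneg _)
    (mul_nonneg (act_nonneg q i) (act_nonneg q j))

lemma pairNorm_sum_le {ι : Type*} (i j : Λ) (s : Finset ι) (A : ι → Op Λ) :
    pairNorm i j (∑ a ∈ s, A a) ≤ ∑ a ∈ s, pairNorm i j (A a) := by
  simp only [pairNorm]
  rw [Finset.sum_comm]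
  refine Finset.sum_le_sum fun q _ => ?_
  rw [← Finset.sum_mul, pauliCoeff_sum]
  exact mul_le_mul_of_nonneg_right (norm_sum_le _ _) (mul_nonneg (act_nonneg q i) (act_nonneg q j))

lemma pairNorm_smul (i j : Λ) (z : ℂ) (A : Op Λ) :
    pairNorm i j (z • A) = ‖z‖ * pairNorm i j A := by
  simp only [pairNorm, pauliCoeff_smul, norm_mul, Finset.mul_sum, mul_assoc]

lemma pairNorm_pauliProd (i j : Λ) (r : Λ → Fin 4) :
    pairNorm i j (pauliProd r) = act r i * act r j := by
  simp [pairNorm, pauliCoeff_pauliProd, apply_ite, ite_mul]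

lemma pauliProdMul_comm (p q : Λ → Fin 4) : pauliProdMul p q = pauliProdMul q p := by
  funext i
  have : ∀ a b, pauliMul a b = pauliMul b a := by decide
  exact this _ _

lemma adOp_pauliProd (p q : Λ → Fin 4) : ∃ z : ℂ, ‖z‖ ≤ 2 ∧
    adOp (pauliProd p) (pauliProd q) = z • pauliProd (pauliProdMul p q) := by
  refine ⟨∏ i, pauliPhase (p i) (q i) - ∏ i, pauliPhase (q i) (p i), ?_, ?_⟩
  · refine (norm_sub_le _ _).trans ?_
    rw [norm_prod_pauliPhase, norm_prod_pauliPhase]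
    norm_num
  · rw [adOp_apply, pauliProd_mul, pauliProd_mul, pauliProdMul_comm q p, sub_smul]

lemma pauliProdMul_of_left {p q : Λ → Fin 4} {i : Λ} (h : p i = 0) :
    pauliProdMul p q i = q i := by rw [pauliProdMul, h, pauliMul_zero_left]

lemma act_pauliProdMul_le (p q : Λ → Fin 4) (i : Λ) :
    act (pauliProdMul p q) i ≤ act p i + act q i := by
  by_cases hp : p i = 0
  · rw [act, pauliProdMul_of_left hp]
    have := act_nonneg p i
    rw [← act]; linarith
  · rw [act_of_ne hp]
    have := act_nonneg q i
    have h1 : act (pauliProdMul p q) i ≤ 1 := by unfold act; split_ifs <;> norm_num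
    linarith

/-- Without a common site `l` the commutator vanishes. Otherwise it is a multiple, of modulus at
most two, of one Pauli product. That product agrees with `q` at `i`, and it can act at `j` only if
`p` or `q` does. -/
lemma pairNorm_adOp_pauliProd_le {p : Λ → Fin 4} {i : Λ} (hp : p i = 0) (q : Λ → Fin 4) (j : Λ) :
    pairNorm i j (adOp (pauliProd p) (pauliProd q)) ≤
      2 * ∑ l, act p l * act q l * (act q i * (act q j + act p j)) := by
  have hnn : ∀ l ∈ Finset.univ, 0 ≤ act p l * act q l * (act q i * (act q j + act p j)) :=
    fun l _ => mul_nonneg (mul_nonneg (act_nonneg _ _) (act_nonneg _ _))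
      (mul_nonneg (act_nonneg _ _) (add_nonneg (act_nonneg _ _) (act_nonneg _ _)))
  by_cases h : ∀ l, p l = 0 ∨ q l = 0
  · have h0 : adOp (pauliProd p) (pauliProd q) = ((0 : ℂ) • (0 : Op Λ)) := by
      rw [adOp_apply, pauliProd_commute h, sub_self, smul_zero]
    rw [h0, pairNorm_smul, norm_zero, zero_mul]
    exact mul_nonneg (by norm_num) (Finset.sum_nonneg hnn)
  · push Not at h
    obtain ⟨l, hpl, hql⟩ := h
    obtain ⟨z, hz, hzq⟩ := adOp_pauliProd p q
    rw [hzq, pairNorm_smul, pairNorm_pauliProd]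
    refine mul_le_mul hz ?_ (mul_nonneg (act_nonneg _ _) (act_nonneg _ _)) (by norm_num)
    refine le_trans ?_ (Finset.single_le_sum hnn (Finset.mem_univ l))
    rw [act_of_ne hpl, act_of_ne hql, one_mul, one_mul]
    have h1 : act (pauliProdMul p q) i = act q i := by rw [act, pauliProdMul_of_left hp, ← act]
    rw [h1]
    refine mul_le_mul_of_nonneg_left ?_ (act_nonneg _ _)
    have := act_pauliProdMul_le p q j
    linarith

lemma adOp_expansion (B A : Op Λ) : adOp B A =
    ∑ p, ∑ q, (pauliCoeff p B * pauliCoeff q A) • adOp (pauliProd p) (pauliProd q) := by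
  have h1 : B * A =
      ∑ p, ∑ q, (pauliCoeff p B * pauliCoeff q A) • (pauliProd p * pauliProd q) := by
    conv_lhs => rw [← pauli_expansion B, ← pauli_expansion A, Finset.sum_mul_sum]
    simp only [smul_mul_smul_comm]
  have h2 : A * B =
      ∑ p, ∑ q, (pauliCoeff p B * pauliCoeff q A) • (pauliProd q * pauliProd p) := by
    conv_lhs => rw [← pauli_expansion B, ← pauli_expansion A, Finset.sum_mul_sum]
    rw [Finset.sum_comm]
    simp only [smul_mul_smul_comm]
    refine Finset.sum_congr rfl fun p _ => Finset.sum_congr rfl fun q _ => ?_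
    rw [mul_comm (pauliCoeff q A)]
  rw [adOp_apply, h1, h2, ← Finset.sum_sub_distrib]
  refine Finset.sum_congr rfl fun p _ => ?_
  rw [← Finset.sum_sub_distrib]
  refine Finset.sum_congr rfl fun q _ => ?_
  rw [← smul_sub, adOp_apply]

/-- `A` is a combination of Pauli products that act on at most `d` sites. -/
def DegreeLE (d : ℕ) (A : Op Λ) : Prop := ∀ q, d < (psupp q).card → pauliCoeff q A = 0

lemma psupp_pauliProdMul_subset (p q : Λ → Fin 4) :
    psupp (pauliProdMul p q) ⊆ psupp p ∪ psupp q := by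
  intro i hi
  rw [Finset.mem_union, mem_psupp, mem_psupp]
  by_contra! h
  refine mem_psupp.1 hi ?_
  rw [pauliProdMul_of_left h.1, h.2]

lemma DegreeLE.adOp {k d : ℕ} {B A : Op Λ} (hB : DegreeLE k B) (hA : DegreeLE d A) :
    DegreeLE (k + d) (adOp B A) := by
  intro r hr
  rw [adOp_expansion, pauliCoeff_sum]
  refine Finset.sum_eq_zero fun p _ => ?_
  rw [pauliCoeff_sum]
  refine Finset.sum_eq_zero fun q _ => ?_
  rw [pauliCoeff_smul]
  by_cases hp : k < (psupp p).card
  · rw [hB p hp]; simp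
  by_cases hq : d < (psupp q).card
  · rw [hA q hq]; simp
  obtain ⟨z, -, hz⟩ := adOp_pauliProd p q
  rw [hz, pauliCoeff_smul, pauliCoeff_pauliProd, if_neg]
  · simp
  rintro rfl
  have h1 := Finset.card_le_card (psupp_pauliProdMul_subset p q)
  have h2 := Finset.card_union_le (psupp p) (psupp q)
  omega

/-- The commutator with an operator that does not act at `i`, in the pair norms at `i`. -/
lemma pairNorm_adOp_le {B A : Op Λ} {i : Λ} {d : ℕ} {g : ℝ}
    (hB : ∀ p, p i ≠ 0 → pauliCoeff p B = 0) (hA : DegreeLE d A)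
    (hg : ∀ l, ∑ p, ‖pauliCoeff p B‖ * act p l ≤ g) (j : Λ) :
    pairNorm i j (adOp B A) ≤
      2 * (d * g * pairNorm i j A + ∑ l, pairNorm i l A * pairNorm l j B) := by
  have h1 : pairNorm i j (adOp B A) ≤ ∑ p, ∑ q, ‖pauliCoeff p B‖ * ‖pauliCoeff q A‖ *
      (2 * ∑ l, act p l * act q l * (act q i * (act q j + act p j))) := by
    rw [adOp_expansion]
    refine (pairNorm_sum_le _ _ _ _).trans (Finset.sum_le_sum fun p _ => ?_)
    refine (pairNorm_sum_le _ _ _ _).trans (Finset.sum_le_sum fun q _ => ?_)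
    rw [pairNorm_smul, norm_mul]
    by_cases hp : p i = 0
    · exact mul_le_mul_of_nonneg_left (pairNorm_adOp_pauliProd_le hp q j) (by positivity)
    · simp [hB p hp]
  -- The summand with `act q j` means that `A` already reaches `j`, and `B` may attach at any site
  -- of `q`. The one with `act p j` means that `B` carries the action from `l` to `j`, which gives a
  -- convolution of pair norms.
  have h2 : ∑ p, ∑ q, ‖pauliCoeff p B‖ * ‖pauliCoeff q A‖ *
      (2 * ∑ l, act p l * act q l * (act q i * (act q j + act p j))) =
      2 * (∑ q, ‖pauliCoeff q A‖ * (act q i * act q j) *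
        ∑ l, act q l * ∑ p, ‖pauliCoeff p B‖ * act p l +
        ∑ l, pairNorm i l A * pairNorm l j B) := by
    have e1 : ∑ q, ‖pauliCoeff q A‖ * (act q i * act q j) *
        ∑ l, act q l * ∑ p, ‖pauliCoeff p B‖ * act p l =
        ∑ p, ∑ q, ∑ l, ‖pauliCoeff q A‖ * (act q i * act q j) *
          (act q l * (‖pauliCoeff p B‖ * act p l)) := by
      simp only [Finset.mul_sum]
      rw [Finset.sum_congr rfl fun q _ => Finset.sum_comm, Finset.sum_comm]
    have e2 : ∑ l, pairNorm i l A * pairNorm l j B = ∑ p, ∑ q, ∑ l,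
        ‖pauliCoeff q A‖ * (act q i * act q l) * (‖pauliCoeff p B‖ * (act p l * act p j)) := by
      simp only [pairNorm, Finset.sum_mul_sum]
      rw [Finset.sum_congr rfl fun l _ => Finset.sum_comm, Finset.sum_comm,
        Finset.sum_congr rfl fun p _ => Finset.sum_comm]
    rw [e1, e2, ← Finset.sum_add_distrib, Finset.mul_sum]
    refine Finset.sum_congr rfl fun p _ => ?_
    rw [← Finset.sum_add_distrib, Finset.mul_sum]
    refine Finset.sum_congr rfl fun q _ => ?_
    rw [← Finset.sum_add_distrib, Finset.mul_sum, Finset.mul_sum, Finset.mul_sum]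
    refine Finset.sum_congr rfl fun l _ => ?_
    ring
  rw [h2] at h1
  refine h1.trans ?_
  gcongr
  rw [pairNorm, Finset.mul_sum]
  refine Finset.sum_le_sum fun q _ => ?_
  have hg0 : 0 ≤ g := (Finset.sum_nonneg fun p _ =>
    mul_nonneg (norm_nonneg _) (act_nonneg p i)).trans (hg i)
  by_cases hq : d < (psupp q).card
  · rw [hA q hq]; simp
  rw [mul_comm]
  refine mul_le_mul_of_nonneg_right ?_
    (mul_nonneg (norm_nonneg _) (mul_nonneg (act_nonneg q i) (act_nonneg q j)))
  calc ∑ l, act q l * ∑ p, ‖pauliCoeff p B‖ * act p l ≤ ∑ l, act q l * g :=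
        Finset.sum_le_sum fun l _ => mul_le_mul_of_nonneg_left (hg l) (act_nonneg q l)
    _ = (psupp q).card * g := by rw [← Finset.sum_mul, sum_act]
    _ ≤ d * g := by
        have : ((psupp q).card : ℝ) ≤ d := by exact_mod_cast not_lt.1 hq
        exact mul_le_mul_of_nonneg_right this hg0

/-- Growth of nested commutators in the pair norms. -/
lemma pairNorm_iterate_adOp_le {B V : Op Λ} {i : Λ} {k : ℕ} {g J lam G : ℝ} {φ : Λ → Λ → ℝ}
    (hB : ∀ p, p i ≠ 0 → pauliCoeff p B = 0) (hBk : DegreeLE k B) (hVk : DegreeLE k V)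
    (hg : ∀ l, ∑ p, ‖pauliCoeff p B‖ * act p l ≤ g)
    (hBJ : ∀ l j, pairNorm l j B ≤ J * φ l j) (hVJ : ∀ j, pairNorm i j V ≤ J * φ i j)
    (hJ : 0 ≤ J) (hφ : ∀ l j, 0 ≤ φ l j) (hconv : ∀ j, ∑ l, φ i l * φ l j ≤ lam * φ i j)
    (hgG : g * k ≤ G) (hlG : lam * J ≤ G) (hG : 0 ≤ G) (n : ℕ) :
    DegreeLE ((n + 1) * k) ((adOp B)^[n] V) ∧
      ∀ j, pairNorm i j ((adOp B)^[n] V) ≤ J * (2 * G) ^ n * (n + 1).factorial * φ i j := by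
  induction n with
  | zero => simpa using ⟨hVk, hVJ⟩
  | succ n ih =>
    obtain ⟨hd, hp⟩ := ih
    simp only [Function.iterate_succ_apply']
    constructor
    · have := hBk.adOp hd
      rwa [show k + (n + 1) * k = (n + 1 + 1) * k by ring] at this
    intro j
    set κ : ℝ := J * (2 * G) ^ n * (n + 1).factorial with hκ
    have hκ0 : 0 ≤ κ := by positivity
    refine (pairNorm_adOp_le hB hd hg j).trans ?_
    have hg0 : 0 ≤ g := (Finset.sum_nonneg fun p _ =>
      mul_nonneg (norm_nonneg _) (act_nonneg p i)).trans (hg i)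
    -- Degree `(n + 1) * k` costs `(n + 1) * G`, and the convolution in `h2` costs one more `G`. The
    -- total factor `2 * G * (n + 2)` turns `(n + 1)!` into `(n + 2)!`.
    have h1 : ((((n + 1) * k : ℕ) : ℝ) * g) * pairNorm i j ((adOp B)^[n] V) ≤
        ((n + 1) * G) * (κ * φ i j) := by
      refine mul_le_mul ?_ (hp j) (pairNorm_nonneg _ _ _) (by positivity)
      push_cast
      calc ((n : ℝ) + 1) * k * g = (n + 1) * (g * k) := by ring
        _ ≤ (n + 1) * G := by gcongr
    have h2 : ∑ l, pairNorm i l ((adOp B)^[n] V) * pairNorm l j B ≤ G * (κ * φ i j) := by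
      calc ∑ l, pairNorm i l ((adOp B)^[n] V) * pairNorm l j B
          ≤ ∑ l, (κ * φ i l) * (J * φ l j) := by
            refine Finset.sum_le_sum fun l _ => ?_
            exact mul_le_mul (hp l) (hBJ l j) (pairNorm_nonneg _ _ _)
              (mul_nonneg hκ0 (hφ i l))
        _ = κ * J * ∑ l, φ i l * φ l j := by
            rw [Finset.mul_sum]
            exact Finset.sum_congr rfl fun l _ => by ring
        _ ≤ κ * J * (lam * φ i j) := by
            exact mul_le_mul_of_nonneg_left (hconv j) (mul_nonneg hκ0 hJ)
        _ = (lam * J) * (κ * φ i j) := by ring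
        _ ≤ G * (κ * φ i j) :=
            mul_le_mul_of_nonneg_right hlG (mul_nonneg hκ0 (hφ i j))
    calc 2 * ((((n + 1) * k : ℕ) : ℝ) * g * pairNorm i j ((adOp B)^[n] V) +
          ∑ l, pairNorm i l ((adOp B)^[n] V) * pairNorm l j B)
        ≤ 2 * (((n + 1) * G) * (κ * φ i j) + G * (κ * φ i j)) := by gcongr
      _ = J * (2 * G) ^ (n + 1) * (n + 1 + 1).factorial * φ i j := by
          rw [hκ, Nat.factorial_succ (n + 1)]
          push_cast
          ring

/-- The pair norms of a perturbation after a short evolution. -/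
lemma pairNorm_evolve_le {B V : Op Λ} {i : Λ} {k : ℕ} {g J lam G : ℝ} {φ : Λ → Λ → ℝ}
    (hB : ∀ p, p i ≠ 0 → pauliCoeff p B = 0) (hBk : DegreeLE k B) (hVk : DegreeLE k V)
    (hg : ∀ l, ∑ p, ‖pauliCoeff p B‖ * act p l ≤ g)
    (hBJ : ∀ l j, pairNorm l j B ≤ J * φ l j) (hVJ : ∀ j, pairNorm i j V ≤ J * φ i j)
    (hJ : 0 ≤ J) (hφ : ∀ l j, 0 ≤ φ l j) (hconv : ∀ j, ∑ l, φ i l * φ l j ≤ lam * φ i j)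
    (hgG : g * k ≤ G) (hlG : lam * J ≤ G) (hG : 0 ≤ G) {s : ℝ} (hs : 0 ≤ s) (hGs : 2 * G * s < 1)
    (j : Λ) :
    pairNorm i j (evolve B s V) ≤ J * φ i j / (1 - 2 * G * s) ^ 2 := by
  have hx0 : 0 ≤ 2 * G * s := by positivity
  -- Dividing `(n + 1)!` by the `n!` of the exponential series leaves `n + 1`, so the majorant is
  -- the derivative of the geometric series.
  have hgeo : HasSum (fun n : ℕ => ((n + 1).choose 1 : ℝ) * (2 * G * s) ^ n)
      (1 / (1 - 2 * G * s) ^ 2) :=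
    hasSum_choose_mul_geometric_of_norm_lt_one 1 (by rwa [Real.norm_of_nonneg hx0])
  have hcont : Continuous (pairNorm i j : Op Λ → ℝ) := by
    unfold pairNorm
    exact continuous_finsetSum _ fun q _ =>
      (continuous_norm.comp (continuous_pauliCoeff q)).mul continuous_const
  have ht := (hcont.tendsto _).comp (hasSum_evolve B V s).tendsto_sum_nat
  refine le_of_tendsto' ht fun N => ?_
  refine (pairNorm_sum_le i j _ _).trans ?_
  calc ∑ n ∈ Finset.range N, pairNorm i j
        (((n.factorial : ℂ)⁻¹ * (Complex.I * s) ^ n) • ((adOp B)^[n] V))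
      ≤ ∑ n ∈ Finset.range N, J * φ i j * (((n + 1).choose 1 : ℝ) * (2 * G * s) ^ n) := by
        refine Finset.sum_le_sum fun n _ => ?_
        have h := (pairNorm_iterate_adOp_le hB hBk hVk hg hBJ hVJ hJ hφ hconv hgG hlG hG n).2 j
        rw [pairNorm_smul]
        have hn : ‖(n.factorial : ℂ)⁻¹ * (Complex.I * s) ^ n‖ = (n.factorial : ℝ)⁻¹ * s ^ n := by
          simp [abs_of_nonneg hs]
        rw [hn]
        have hf : (n.factorial : ℝ) ≠ 0 := by positivity
        refine (mul_le_mul_of_nonneg_left h (by positivity)).trans_eq ?_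
        rw [Nat.factorial_succ, Nat.choose_one_right]
        push_cast
        field_simp
        ring
    _ = J * φ i j * ∑ n ∈ Finset.range N, (((n + 1).choose 1 : ℝ) * (2 * G * s) ^ n) := by
        rw [Finset.mul_sum]
    _ ≤ J * φ i j * (1 / (1 - 2 * G * s) ^ 2) := by
        refine mul_le_mul_of_nonneg_left ?_ (mul_nonneg hJ (hφ i j))
        exact sum_le_hasSum _ (fun n _ => by positivity) hgeo
    _ = J * φ i j / (1 - 2 * G * s) ^ 2 := by ring

end Growth

/-! ### Interaction-picture derivatives and growth of Hilbert space norms. -/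

section Interaction

variable {𝔸 : Type*} [NormedRing 𝔸] [NormedAlgebra ℂ 𝔸] [CompleteSpace 𝔸]

/-- The derivative in the interaction picture. -/
lemma hasDerivAt_interaction (H H₀ W : 𝔸) (t z : ℂ) {C V : 𝔸}
    (hC : C = NormedSpace.exp ((Complex.I * (t - z)) • H₀) *
      (NormedSpace.exp ((Complex.I * z) • H) * W * NormedSpace.exp ((-(Complex.I * z)) • H)) *
      NormedSpace.exp ((-(Complex.I * (t - z))) • H₀))
    (hV : V = NormedSpace.exp ((Complex.I * (t - z)) • H₀) * (H - H₀) *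
      NormedSpace.exp ((-(Complex.I * (t - z))) • H₀)) :
    HasDerivAt (fun u : ℂ => NormedSpace.exp ((Complex.I * (t - u)) • H₀) *
      (NormedSpace.exp ((Complex.I * u) • H) * W * NormedSpace.exp ((-(Complex.I * u)) • H)) *
      NormedSpace.exp ((-(Complex.I * (t - u))) • H₀)) (Complex.I • (V * C - C * V)) z := by
  have hm : HasDerivAt (fun u : ℂ => Complex.I * u) Complex.I z := by
    simpa using (hasDerivAt_id z).const_mul Complex.I
  have hs : HasDerivAt (fun u : ℂ => Complex.I * (t - u)) (-Complex.I) z := by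
    simpa using ((hasDerivAt_id z).const_sub t).const_mul Complex.I
  have hX := (hasDerivAt_conj_exp H W (Complex.I * z)).scomp z hm
  have hA := (hasDerivAt_exp_smul_const H₀ (Complex.I * (t - z))).scomp z hs
  have hB := (hasDerivAt_exp_smul_const' H₀ (-(Complex.I * (t - z)))).scomp z hs.neg
  have h := (hA.mul hX).mul hB
  have hBA : NormedSpace.exp ((-(Complex.I * (t - z))) • H₀) *
      NormedSpace.exp ((Complex.I * (t - z)) • H₀) = 1 := by
    simpa using exp_smul_mul_exp_neg H₀ (-(Complex.I * (t - z)))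
  convert! h using 1
  simp only [Function.comp_apply, Pi.mul_apply, Pi.neg_apply]
  rw [hC, hV]
  generalize NormedSpace.exp ((-(Complex.I * (t - z))) • H₀) = B at *
  generalize NormedSpace.exp ((Complex.I * (t - z)) • H₀) = A at *
  generalize (NormedSpace.exp ((Complex.I * z) • H) * W *
    NormedSpace.exp ((-(Complex.I * z)) • H)) = X at *
  have e1 : A * (H - H₀) * B * (A * X * B) = A * (H - H₀) * X * B := by
    calc A * (H - H₀) * B * (A * X * B) = A * (H - H₀) * (B * A) * X * B := by noncomm_ring
      _ = _ := by rw [hBA, mul_one]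
  have e2 : A * X * B * (A * (H - H₀) * B) = A * X * (H - H₀) * B := by
    calc A * X * B * (A * (H - H₀) * B) = A * X * (B * A) * (H - H₀) * B := by noncomm_ring
      _ = _ := by rw [hBA, mul_one]
  rw [e1, e2, neg_neg]
  simp only [neg_smul, smul_mul_assoc, mul_smul_comm, neg_mul, add_mul, ← smul_neg, ← smul_add]
  congr 1
  noncomm_ring

lemma hasDerivAt_clm_comp_ofReal {E : Type*} [NormedAddCommGroup E] [InnerProductSpace ℂ E]
    {F : ℂ → 𝔸} {F' : 𝔸} {u : ℝ} (h : HasDerivAt F F' (u : ℂ)) (P : 𝔸 →L[ℂ] E) :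
    HasDerivAt (fun v : ℝ => P (F v)) (P F') u := by
  have h2 := P.hasFDerivAt.comp_hasDerivAt (u : ℂ) h
  have h3 := h2.scomp u (Complex.ofRealCLM.hasDerivAt)
  rw [Complex.ofRealCLM_apply, Complex.ofReal_one, one_smul] at h3
  exact h3

end Interaction

lemma norm_le_of_inner_deriv_le {E : Type*} [NormedAddCommGroup E] [InnerProductSpace ℝ E]
    {x x' : ℝ → E} {K t : ℝ} (ht : 0 ≤ t) (hK : 0 ≤ K) (hx : ∀ u, HasDerivAt x (x' u) u)
    (hx0 : x 0 = 0) (hin : ∀ u, 0 ≤ u → u ≤ t → inner ℝ (x u) (x' u) ≤ K * ‖x u‖) :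
    ‖x t‖ ≤ K * t := by
  -- The norm need not be differentiable at zero, where the path starts. The smooth function `√(‖x‖²
  -- + δ²)` starts at `δ`, has slope at most `K`, and dominates the norm.
  refine le_of_forall_pos_le_add fun δ hδ => ?_
  have hpos : ∀ u, 0 < ‖x u‖ ^ 2 + δ ^ 2 := fun u => by positivity
  have hd : ∀ u, HasDerivAt (fun u => Real.sqrt (‖x u‖ ^ 2 + δ ^ 2))
      (2 * inner ℝ (x u) (x' u) / (2 * Real.sqrt (‖x u‖ ^ 2 + δ ^ 2))) u := fun u =>
    ((hx u).norm_sq.add_const _).sqrt (hpos u).ne'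
  have h := Convex.image_sub_le_mul_sub_of_deriv_le (convex_Icc 0 t)
    (f := fun u => Real.sqrt (‖x u‖ ^ 2 + δ ^ 2))
    (fun u _ => (hd u).continuousAt.continuousWithinAt)
    (fun u _ => (hd u).differentiableAt.differentiableWithinAt) (C := K) (by
      intro u hu
      have hu' := interior_subset hu
      rw [(hd u).deriv, mul_div_mul_left _ _ two_ne_zero, div_le_iff₀ (Real.sqrt_pos.2 (hpos u))]
      refine (hin u hu'.1 hu'.2).trans (mul_le_mul_of_nonneg_left ?_ hK)
      exact Real.le_sqrt_of_sq_le (by nlinarith)) 0 ⟨le_rfl, ht⟩ t ⟨ht, le_rfl⟩ ht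
  have h0 : Real.sqrt (‖x 0‖ ^ 2 + δ ^ 2) = δ := by
    rw [hx0]; simp [Real.sqrt_sq hδ.le]
  have h1 : ‖x t‖ ≤ Real.sqrt (‖x t‖ ^ 2 + δ ^ 2) := Real.le_sqrt_of_sq_le (by nlinarith)
  simp only [h0] at h
  linarith

lemma norm_le_of_re_inner_deriv_le {E : Type*} [NormedAddCommGroup E] [InnerProductSpace ℂ E]
    {x x' : ℝ → E} {K t : ℝ} (ht : 0 ≤ t) (hK : 0 ≤ K) (hx : ∀ u, HasDerivAt x (x' u) u)
    (hx0 : x 0 = 0) (hin : ∀ u, 0 ≤ u → u ≤ t → (inner ℂ (x u) (x' u)).re ≤ K * ‖x u‖) :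
    ‖x t‖ ≤ K * t := by
  let _ : InnerProductSpace ℝ E := InnerProductSpace.complexToReal
  exact norm_le_of_inner_deriv_le ht hK hx hx0 hin

/-! ### Leakage out of a region during one evolution. -/

section Step

variable {Λ : Type*} [Fintype Λ] [DecidableEq Λ]

lemma inner_pauliVec (A B : Op Λ) : inner ℂ (pauliVec A) (pauliVec B) = ntr (Aᴴ * B) := by
  have h : Aᴴ = ∑ p, star (pauliCoeff p A) • pauliProd p := by
    conv_lhs => rw [← pauli_expansion A]
    simp only [Matrix.conjTranspose_sum, Matrix.conjTranspose_smul, pauliProd_conjTranspose]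
  rw [h, Finset.sum_mul, ntr, Matrix.trace_sum, Finset.sum_div, PiLp.inner_apply]
  refine Finset.sum_congr rfl fun p _ => ?_
  rw [← ntr, Matrix.smul_mul, ntr_smul, ← pauliCoeff, pauliVec_apply, pauliVec_apply]
  simp [mul_comm]

lemma ntr_conjTranspose (A : Op Λ) : ntr Aᴴ = star (ntr A) := by
  simp [ntr, Matrix.trace_conjTranspose]

lemma ntr_im_eq_zero {A : Op Λ} (h : A.IsHermitian) : (ntr A).im = 0 := by
  have := ntr_conjTranspose A
  rw [h.eq] at this
  exact Complex.conj_eq_iff_im.1 this.symm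

/-- A Hermitian generator does not change the Frobenius norm. -/
lemma re_inner_commutator_eq_zero {V : Op Λ} (hV : V.IsHermitian) (q : Op Λ) :
    (inner ℂ (pauliVec q) (pauliVec (Complex.I • (V * q - q * V)))).re = 0 := by
  rw [map_smul, inner_smul_right, inner_pauliVec]
  have h1 : (ntr (qᴴ * V * q)).im = 0 := by
    refine ntr_im_eq_zero ?_
    rw [Matrix.IsHermitian]
    simp [Matrix.conjTranspose_mul, hV.eq, mul_assoc]
  have h2 : (ntr (q * V * qᴴ)).im = 0 := by
    refine ntr_im_eq_zero ?_
    rw [Matrix.IsHermitian]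
    simp [Matrix.conjTranspose_mul, hV.eq, mul_assoc]
  have h3 : ntr (qᴴ * (V * q - q * V)) = ntr (qᴴ * V * q) - ntr (q * V * qᴴ) := by
    simp only [ntr, ← sub_div]
    rw [mul_sub, Matrix.trace_sub, ← mul_assoc]
    congr 2
    rw [Matrix.trace_mul_comm]
  rw [h3]
  simp [Complex.mul_re, h1, h2]

lemma isHermitian_trunc {V : Op Λ} (hV : V.IsHermitian) (Y : Finset Λ) :
    (trunc Y V).IsHermitian := by
  refine pauliCoeff_ext fun p => ?_
  rw [pauliCoeff_conjTranspose, pauliCoeff_trunc]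
  split_ifs with h
  · rw [← pauliCoeff_conjTranspose, hV.eq]
  · simp

lemma isHermitian_evolve {H V : Op Λ} (hH : H.IsHermitian) (hV : V.IsHermitian) (t : ℝ) :
    (evolve H t V).IsHermitian := by
  have h1 := conjTranspose_exp_I H hH t
  have h2 := congrArg Matrix.conjTranspose h1
  rw [Matrix.conjTranspose_conjTranspose] at h2
  rw [Matrix.IsHermitian, evolve, Matrix.conjTranspose_mul, Matrix.conjTranspose_mul, h1, ← h2,
    hV.eq, mul_assoc]

/-- The rate at which a Hermitian generator `V` moves `C` off `Y`. -/
lemma re_inner_leak_le {V : Op Λ} (hV : V.IsHermitian) (Y : Finset Λ) (C : Op Λ) :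
    (inner ℂ (pauliVec (C - trunc Y C)) (pauliVec (Complex.I • (V * C - C * V) -
      trunc Y (Complex.I • (V * C - C * V))))).re ≤
      2 * frobNorm (V - trunc Y V) * opNorm C * ‖pauliVec (C - trunc Y C)‖ := by
  set q := C - trunc Y C with hq
  set M := (V - trunc Y V) * C - C * (V - trunc Y V) with hM
  -- By the bimodule property, commutation with `trunc Y V` maps the component `q` off `Y` to
  -- itself. That part of the generator is Hermitian and drops out of the real inner product, so
  -- only `V - trunc Y V` contributes growth.
  have hsplit : Complex.I • (V * C - C * V) - trunc Y (Complex.I • (V * C - C * V)) =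
      Complex.I • (M - trunc Y M) + Complex.I • (trunc Y V * q - q * trunc Y V) := by
    have h1 : trunc Y (trunc Y V * C - C * trunc Y V) =
        trunc Y V * trunc Y C - trunc Y C * trunc Y V := by
      rw [map_sub, trunc_mul_left (supportedOn_trunc Y V), trunc_mul_right (supportedOn_trunc Y V)]
    have h2 : V * C - C * V = M + (trunc Y V * C - C * trunc Y V) := by
      rw [hM]; noncomm_ring
    rw [h2, map_smul, map_add, h1, ← smul_sub, ← smul_add]
    congr 1
    rw [hq]
    noncomm_ring
  rw [hsplit, map_add, inner_add_right, Complex.add_re,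
    re_inner_commutator_eq_zero (isHermitian_trunc hV Y), add_zero]
  refine (Complex.re_le_norm _).trans ((norm_inner_le_norm _ _).trans ?_)
  rw [mul_comm]
  refine mul_le_mul_of_nonneg_right ?_ (norm_nonneg _)
  rw [map_smul, norm_smul, Complex.norm_I, one_mul, ← frobNorm_eq_norm]
  exact (frobNorm_sub_trunc_le Y M).trans (frobNorm_commutator_le _ _)

open scoped Matrix.Norms.L2Operator in
/-- The error of the truncation to `Y` after a short evolution, in terms of the part of the
interaction-picture perturbation that acts off `Y`. -/
lemma frobNorm_evolve_sub_trunc_le {H H₀ W : Op Λ} {X Y : Finset Λ} {K t : ℝ}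
    (hH : H.IsHermitian) (hH₀ : H₀.IsHermitian) (hX : SupportedOn Xᶜ H₀) (hW : SupportedOn X W)
    (hXY : X ⊆ Y) (hW1 : opNorm W ≤ 1) (ht : 0 ≤ t) (hK : 0 ≤ K)
    (hV : ∀ s, 0 ≤ s → s ≤ t →
      frobNorm (evolve H₀ s (H - H₀) - trunc Y (evolve H₀ s (H - H₀))) ≤ K) :
    frobNorm (evolve H t W - trunc Y (evolve H t W)) ≤ 2 * K * t := by
  let P : Op Λ →L[ℂ] EuclideanSpace ℂ (Λ → Fin 4) :=
    LinearMap.toContinuousLinearMap (pauliVec ∘ₗ (LinearMap.id - trunc Y))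
  have hP : ∀ A, P A = pauliVec (A - trunc Y A) := fun A => rfl
  -- This path runs from `evolve H₀ t W`, which is `W` because `H₀` acts off `X`, to `evolve H t W`.
  -- Its generator at `u` is the perturbation evolved under `H₀` for the remaining time `t - u`.
  let C : ℝ → Op Λ := fun u => evolve H₀ (t - u) (evolve H u W)
  let V : ℝ → Op Λ := fun u => evolve H₀ (t - u) (H - H₀)
  have hd : ∀ u : ℝ, HasDerivAt (fun u : ℝ => P (C u))
      (P (Complex.I • (V u * C u - C u * V u))) u := by
    intro u
    have h1 := hasDerivAt_interaction H H₀ W (t : ℂ) (u : ℂ) rfl rfl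
    have h2 := hasDerivAt_clm_comp_ofReal h1 P
    simp only [C, V, evolve, Complex.ofReal_sub]
    exact h2
  have hcomm : ∀ s, evolve H₀ s W = W := by
    intro s
    have h1 := (hX.exp (Complex.I * (s : ℂ))).commute hW disjoint_compl_left
    have h2 := exp_smul_mul_exp_neg_smul H₀ (Complex.I * (s : ℂ))
    rw [evolve, h1, mul_assoc, h2, mul_one]
  have h0 : P (C 0) = 0 := by
    have : C 0 = W := by
      simp only [C, evolve_zero_time, hcomm]
    rw [this, hP, trunc_eq_self (hW.mono hXY), sub_self, map_zero]
  have hfin := norm_le_of_re_inner_deriv_le (K := 2 * K) ht (by positivity) hd h0 (by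
    intro u hu0 hut
    refine (re_inner_leak_le (isHermitian_evolve hH₀ (hH.sub hH₀) (t - u)) Y (C u)).trans ?_
    have hC1 : opNorm (C u) ≤ 1 :=
      (opNorm_evolve_le H₀ hH₀ _ _).trans ((opNorm_evolve_le H hH _ _).trans hW1)
    have hVu := hV (t - u) (by linarith) (by linarith)
    rw [hP]
    refine mul_le_mul_of_nonneg_right ?_ (norm_nonneg _)
    calc 2 * frobNorm (V u - trunc Y (V u)) * opNorm (C u) ≤ 2 * K * 1 :=
          mul_le_mul (by linarith) hC1 (opNorm_nonneg _) (by linarith)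
      _ = 2 * K := mul_one _)
  have : C t = evolve H t W := by
    simp only [C, sub_self, evolve_zero_time]
  rwa [hP, this, ← frobNorm_eq_norm] at hfin

end Step

/-! ### Pauli weights of the Hamiltonian and the error of one step. -/

section Coefficients

variable {Λ : Type*} [Fintype Λ] [DecidableEq Λ]

/-- Cauchy–Schwarz and Parseval. Applied to a term of the Hamiltonian, the square root of the number
of labels becomes the factor `3^{k/2}` or `4^{k/2}` in `J`. -/
lemma sum_norm_pauliCoeff_le {A : Op Λ} (s : Finset (Λ → Fin 4))
    (hs : ∀ p, p ∉ s → pauliCoeff p A = 0) :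
    ∑ p, ‖pauliCoeff p A‖ ≤ Real.sqrt s.card * frobNorm A := by
  have h1 : ∑ p, ‖pauliCoeff p A‖ = ∑ p ∈ s, ‖pauliCoeff p A‖ := by
    symm
    refine Finset.sum_subset (Finset.subset_univ s) fun p _ hp => ?_
    rw [hs p hp, norm_zero]
  rw [h1, ← Real.sqrt_sq (frobNorm_nonneg A), ← Real.sqrt_mul (by positivity)]
  refine Real.le_sqrt_of_sq_le (sq_sum_le_card_mul_sum_sq.trans ?_)
  rw [frobNorm_sq]
  gcongr
  exact Finset.subset_univ s

lemma pauliCoeff_eq_zero_of_isPauliSumOn {Z : Finset Λ} {A : Op Λ} (h : IsPauliSumOn Z A)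
    {p : Λ → Fin 4} (hp : ¬ ∀ i, p i ≠ 0 ↔ i ∈ Z) : pauliCoeff p A = 0 := by
  have hle : Submodule.span ℂ
      {P : Op Λ | ∃ p : Λ → Fin 4, (∀ i, p i ≠ 0 ↔ i ∈ Z) ∧ P = pauliProd p} ≤
      LinearMap.ker (pauliCoeffₗ p) := by
    rw [Submodule.span_le]
    rintro _ ⟨q, hq, rfl⟩
    rw [SetLike.mem_coe, LinearMap.mem_ker, pauliCoeffₗ_apply, pauliCoeff_pauliProd, if_neg]
    rintro rfl
    exact hp hq
  exact hle h

lemma card_piFinset_ite (Z : Finset Λ) (s : Finset (Fin 4)) :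
    (Fintype.piFinset fun i => if i ∈ Z then s else {0}).card = s.card ^ Z.card := by
  rw [Fintype.card_piFinset]
  have : ∀ i, (if i ∈ Z then s else ({0} : Finset (Fin 4))).card =
      if i ∈ Z then s.card else 1 := by
    intro i; split_ifs <;> simp
  simp only [this]
  rw [Finset.prod_ite, Finset.prod_const_one, mul_one, Finset.prod_const]
  simp

lemma one_le_pauliBase (h : Finset Λ → Op Λ) : 1 ≤ pauliBase h := by
  unfold pauliBase; split_ifs <;> norm_num

lemma pauliBase_le (h : Finset Λ → Op Λ) : pauliBase h ≤ 4 := by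
  unfold pauliBase; split_ifs <;> norm_num

lemma sqrt_pow_le_rpow {b : ℝ} (hb : 1 ≤ b) {n k : ℕ} (hnk : n ≤ k) :
    Real.sqrt (b ^ n) ≤ b ^ ((k : ℝ) / 2) := by
  rw [Real.sqrt_eq_rpow, ← Real.rpow_natCast, ← Real.rpow_mul (by linarith)]
  refine Real.rpow_le_rpow_of_exponent_le hb ?_
  have : (n : ℝ) ≤ k := by exact_mod_cast hnk
  linarith

/-- The Pauli coefficients of a term of the Hamiltonian. -/
lemma sum_norm_pauliCoeff_term_le {G : SimpleGraph Λ} {h : Finset Λ → Op Λ} {k : ℕ} {α J₀ : ℝ}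
    (hP : IsPowerLaw G h k α J₀) (Z : Finset Λ) :
    ∑ p, ‖pauliCoeff p (h Z)‖ ≤ pauliBase h ^ ((k : ℝ) / 2) * opNorm (h Z) := by
  have hb := one_le_pauliBase h
  by_cases hk : k < Z.card
  · rw [hP.klocal Z hk]
    simp only [pauliCoeff_zero, norm_zero, Finset.sum_const_zero]
    exact mul_nonneg (by positivity) (opNorm_nonneg _)
  obtain ⟨s, hs, hcard⟩ : ∃ s : Finset (Λ → Fin 4), (∀ p, p ∉ s → pauliCoeff p (h Z) = 0) ∧
      (s.card : ℝ) = pauliBase h ^ Z.card := by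
    by_cases hS : ∀ Z, IsPauliSumOn Z (h Z)
    · refine ⟨Fintype.piFinset fun i => if i ∈ Z then Finset.univ.erase 0 else {0}, ?_, ?_⟩
      · intro p hp
        refine pauliCoeff_eq_zero_of_isPauliSumOn (hS Z) fun hp' => hp ?_
        refine Fintype.mem_piFinset.2 fun i => ?_
        split_ifs with hi
        · simpa using (hp' i).2 hi
        · simpa using fun h0 => hi ((hp' i).1 h0)
      · rw [card_piFinset_ite, pauliBase, if_pos hS]
        simp
    · refine ⟨Fintype.piFinset fun i => if i ∈ Z then Finset.univ else {0}, ?_, ?_⟩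
      · intro p hp
        refine (supportedOn_iff Z (h Z)).1 (hP.supported Z) p fun hp' => hp ?_
        refine Fintype.mem_piFinset.2 fun i => ?_
        split_ifs with hi
        · simp
        · simpa using fun h0 => hi (hp' (mem_psupp.2 h0))
      · rw [card_piFinset_ite, pauliBase, if_neg hS]
        simp
  refine (sum_norm_pauliCoeff_le s hs).trans ?_
  rw [hcard]
  exact mul_le_mul (sqrt_pow_le_rpow hb (not_lt.1 hk)) (frobNorm_le_opNorm _) (frobNorm_nonneg _)
    (by positivity)

lemma norm_pauliCoeff_hamiltonian_le (h : Finset Λ → Op Λ) (p : Λ → Fin 4) :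
    ‖pauliCoeff p (hamiltonian h)‖ ≤ ∑ Z, ‖pauliCoeff p (h Z)‖ := by
  rw [hamiltonian, pauliCoeff_sum]
  exact norm_sum_le _ _

lemma act_le_one (q : Λ → Fin 4) (i : Λ) : act q i ≤ 1 := by
  unfold act; split_ifs <;> norm_num

lemma norm_pauliCoeff_mul_act_eq_zero {Z : Finset Λ} {A : Op Λ} (hA : SupportedOn Z A)
    {l : Λ} (hl : l ∉ Z) (p : Λ → Fin 4) : ‖pauliCoeff p A‖ * act p l = 0 := by
  by_cases hp : p l = 0
  · simp [act, hp]
  · rw [(supportedOn_iff Z A).1 hA p fun h => hl (h (mem_psupp.2 hp)), norm_zero, zero_mul]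

variable {G : SimpleGraph Λ} {h : Finset Λ → Op Λ} {k : ℕ} {α J₀ : ℝ}

lemma sum_pauliCoeff_hamiltonian_act_le (hP : IsPowerLaw G h k α J₀) {g : ℝ}
    (hg : IsSiteEnergy h g) (l : Λ) :
    ∑ p, ‖pauliCoeff p (hamiltonian h)‖ * act p l ≤ g := by
  refine le_trans ?_ (hg l)
  calc ∑ p, ‖pauliCoeff p (hamiltonian h)‖ * act p l
      ≤ ∑ p, ∑ Z, ‖pauliCoeff p (h Z)‖ * act p l := by
        refine Finset.sum_le_sum fun p _ => ?_
        rw [← Finset.sum_mul]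
        exact mul_le_mul_of_nonneg_right (norm_pauliCoeff_hamiltonian_le h p) (act_nonneg p l)
    _ = ∑ Z ∈ Finset.univ.filter (fun Z : Finset Λ => l ∈ Z),
          ∑ p ∈ Finset.univ.filter (fun p : Λ → Fin 4 => p l ≠ 0), ‖pauliCoeff p (h Z)‖ := by
        rw [Finset.sum_comm, Finset.sum_filter]
        refine Finset.sum_congr rfl fun Z _ => ?_
        split_ifs with hZ
        · rw [Finset.sum_filter]
          refine Finset.sum_congr rfl fun p _ => ?_
          by_cases hp : p l = 0 <;> simp [act, hp]
        · exact Finset.sum_eq_zero fun p _ =>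
            norm_pauliCoeff_mul_act_eq_zero (hP.supported Z) hZ p

lemma pairNorm_hamiltonian_le (hP : IsPowerLaw G h k α J₀) (l j : Λ) :
    pairNorm l j (hamiltonian h) ≤
      pauliBase h ^ ((k : ℝ) / 2) * J₀ * ((G.dist l j : ℝ) + 1) ^ (-α) := by
  have hb : 0 ≤ pauliBase h ^ ((k : ℝ) / 2) :=
    Real.rpow_nonneg (zero_le_one.trans (one_le_pauliBase h)) _
  calc pairNorm l j (hamiltonian h) ≤ ∑ Z, pairNorm l j (h Z) := pairNorm_sum_le _ _ _ _
    _ ≤ ∑ Z ∈ Finset.univ.filter (fun Z : Finset Λ => l ∈ Z ∧ j ∈ Z),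
          pauliBase h ^ ((k : ℝ) / 2) * opNorm (h Z) := by
        rw [Finset.sum_filter]
        refine Finset.sum_le_sum fun Z _ => ?_
        split_ifs with hZ
        · refine le_trans (Finset.sum_le_sum fun p _ => ?_) (sum_norm_pauliCoeff_term_le hP Z)
          exact mul_le_of_le_one_right (norm_nonneg _)
            (mul_le_one₀ (act_le_one p l) (act_nonneg p j) (act_le_one p j))
        · refine (Finset.sum_eq_zero fun p _ => ?_).le
          by_cases hl : l ∈ Z
          · have hj : j ∉ Z := fun hj => hZ ⟨hl, hj⟩
            rw [mul_left_comm, norm_pauliCoeff_mul_act_eq_zero (hP.supported Z) hj, mul_zero]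
          · rw [← mul_assoc, norm_pauliCoeff_mul_act_eq_zero (hP.supported Z) hl, zero_mul]
    _ ≤ pauliBase h ^ ((k : ℝ) / 2) * (J₀ * ((G.dist l j : ℝ) + 1) ^ (-α)) := by
        rw [← Finset.mul_sum]
        exact mul_le_mul_of_nonneg_left (hP.decay l j) hb
    _ = _ := by ring

lemma degreeLE_hamiltonian (hP : IsPowerLaw G h k α J₀) : DegreeLE k (hamiltonian h) := by
  intro q hq
  rw [hamiltonian, pauliCoeff_sum]
  refine Finset.sum_eq_zero fun Z _ => ?_
  by_cases hZ : psupp q ⊆ Z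
  · rw [hP.klocal Z (hq.trans_le (Finset.card_le_card hZ)), pauliCoeff_zero]
  · exact (supportedOn_iff Z (h Z)).1 (hP.supported Z) q hZ

lemma isHermitian_hamiltonian (hP : IsPowerLaw G h k α J₀) : (hamiltonian h).IsHermitian := by
  rw [Matrix.IsHermitian, hamiltonian, Matrix.conjTranspose_sum]
  exact Finset.sum_congr rfl fun Z _ => (hP.hermitian Z).eq

lemma norm_pauliCoeff_trunc_le (Y : Finset Λ) (A : Op Λ) (p : Λ → Fin 4) :
    ‖pauliCoeff p (trunc Y A)‖ ≤ ‖pauliCoeff p A‖ := by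
  rw [pauliCoeff_trunc]; split_ifs <;> simp

lemma norm_pauliCoeff_sub_trunc_le (Y : Finset Λ) (A : Op Λ) (p : Λ → Fin 4) :
    ‖pauliCoeff p (A - trunc Y A)‖ ≤ ‖pauliCoeff p A‖ := by
  rw [pauliCoeff_sub, pauliCoeff_trunc]; split_ifs <;> simp

lemma pairNorm_mono {A B : Op Λ} (hAB : ∀ p, ‖pauliCoeff p A‖ ≤ ‖pauliCoeff p B‖) (i j : Λ) :
    pairNorm i j A ≤ pairNorm i j B :=
  Finset.sum_le_sum fun p _ => mul_le_mul_of_nonneg_right (hAB p)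
    (mul_nonneg (act_nonneg p i) (act_nonneg p j))

lemma DegreeLE.mono {d : ℕ} {A B : Op Λ} (hB : DegreeLE d B)
    (hAB : ∀ p, ‖pauliCoeff p A‖ ≤ ‖pauliCoeff p B‖) : DegreeLE d A := by
  intro q hq
  have := hAB q
  rw [hB q hq, norm_zero] at this
  exact norm_le_zero_iff.1 this

/-- The part off `Y` of an operator all of whose Pauli products act somewhere on `X`. -/
lemma frobNorm_sub_trunc_sq_le {A : Op Λ} {X Y : Finset Λ} (hA : trunc Xᶜ A = 0) :
    frobNorm (A - trunc Y A) ^ 2 ≤ ∑ i ∈ X, ∑ j ∈ Yᶜ, pairNorm i j A ^ 2 := by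
  have hX : ∀ p, psupp p ⊆ Xᶜ → pauliCoeff p A = 0 := by
    intro p hp
    have := pauliCoeff_trunc Xᶜ A p
    rwa [hA, pauliCoeff_zero, if_pos hp, eq_comm] at this
  have hnn : ∀ (p : Λ → Fin 4) i j, 0 ≤ ‖pauliCoeff p A‖ * (act p i * act p j) := fun p i j =>
    mul_nonneg (norm_nonneg _) (mul_nonneg (act_nonneg p i) (act_nonneg p j))
  calc frobNorm (A - trunc Y A) ^ 2
      = ∑ p ∈ Finset.univ.filter (fun p => ¬ psupp p ⊆ Y), ‖pauliCoeff p A‖ ^ 2 :=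
        frobNorm_sub_trunc_sq Y A
    _ ≤ ∑ p ∈ Finset.univ.filter (fun p => ¬ psupp p ⊆ Y),
          ∑ i ∈ X, ∑ j ∈ Yᶜ, (‖pauliCoeff p A‖ * (act p i * act p j)) ^ 2 := by
        refine Finset.sum_le_sum fun p hp => ?_
        by_cases hpX : psupp p ⊆ Xᶜ
        · rw [hX p hpX]; simp
        obtain ⟨j, hj, hjY⟩ := Finset.not_subset.1 (Finset.mem_filter.1 hp).2
        obtain ⟨i, hi, hiX⟩ := Finset.not_subset.1 hpX
        -- A Pauli product not contained in `Y` has a site `j` outside `Y`; by the hypothesis on `A`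
        -- it also has a site `i` in `X`. It is therefore counted by this pair.
        have h1 : ‖pauliCoeff p A‖ ^ 2 = (‖pauliCoeff p A‖ * (act p i * act p j)) ^ 2 := by
          rw [act_of_ne (mem_psupp.1 hi), act_of_ne (mem_psupp.1 hj), mul_one, mul_one]
        rw [h1]
        refine le_trans ?_ (Finset.single_le_sum (f := fun i => ∑ j ∈ Yᶜ,
          (‖pauliCoeff p A‖ * (act p i * act p j)) ^ 2)
          (fun i _ => Finset.sum_nonneg fun j _ => sq_nonneg _) (a := i) (by simpa using hiX))
        exact Finset.single_le_sum (f := fun j => (‖pauliCoeff p A‖ * (act p i * act p j)) ^ 2)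
          (fun j _ => sq_nonneg _) (by simpa using hjY)
    _ ≤ ∑ p, ∑ i ∈ X, ∑ j ∈ Yᶜ, (‖pauliCoeff p A‖ * (act p i * act p j)) ^ 2 :=
        Finset.sum_le_sum_of_subset_of_nonneg (Finset.filter_subset _ _) fun p _ _ =>
          Finset.sum_nonneg fun i _ => Finset.sum_nonneg fun j _ => sq_nonneg _
    _ = ∑ i ∈ X, ∑ j ∈ Yᶜ, ∑ p, (‖pauliCoeff p A‖ * (act p i * act p j)) ^ 2 := by
        rw [Finset.sum_comm]
        exact Finset.sum_congr rfl fun i _ => Finset.sum_comm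
    _ ≤ ∑ i ∈ X, ∑ j ∈ Yᶜ, pairNorm i j A ^ 2 := by
        refine Finset.sum_le_sum fun i _ => Finset.sum_le_sum fun j _ => ?_
        exact Finset.sum_sq_le_sq_sum_of_nonneg fun p _ => hnn p i j

/-- The diagonal term at `i` alone contributes one. Consequently `J ≤ λJ ≤ g̃`, which lets `g̃`
replace `J` in the step error. -/
lemma one_le_of_isConvConst {α lam : ℝ} (i : Λ) (hl : IsConvConst G α lam) : 1 ≤ lam := by
  have h1 := hl i i
  have h2 := Finset.single_le_sum (f := fun j => ((G.dist i j : ℝ) + 1) ^ (-α) *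
    ((G.dist j i : ℝ) + 1) ^ (-α)) (fun j _ => by positivity) (Finset.mem_univ i)
  simp only [SimpleGraph.dist_self, Nat.cast_zero, zero_add, Real.one_rpow, mul_one] at h1 h2
  linarith

lemma nonneg_of_isPowerLaw (i : Λ) (hP : IsPowerLaw G h k α J₀) : 0 ≤ J₀ := by
  have h1 := hP.decay i i
  simp only [SimpleGraph.dist_self, Nat.cast_zero, zero_add, Real.one_rpow, mul_one] at h1
  exact (Finset.sum_nonneg fun Z _ => opNorm_nonneg (h Z)).trans h1

/-- Since `1 / e < 0.4`, the square is at least `0.36`. This bounds the sum of the commutator series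
by three. -/
lemma one_sub_sq_bound {x : ℝ} (hx : Real.exp 1 * x < 1) : 1 / 3 ≤ (1 - x) ^ 2 := by
  have he := Real.exp_one_gt_d9
  have h1 : x ≤ 0.4 := by
    by_contra! h
    nlinarith
  nlinarith

/-- The error of one time step. -/
lemma frobNorm_time_step_le (hP : IsPowerLaw G h k α J₀) {lam g t : ℝ} (hl : IsConvConst G α lam)
    (hg : IsSiteEnergy h g) (ht : 0 ≤ t) (hsmall : 2 * Real.exp 1 * gTilde h k J₀ lam g * t < 1)
    {X Y : Finset Λ} (hXY : X ⊆ Y) (hXne : X.Nonempty) {W : Op Λ} (hW : SupportedOn X W)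
    (hW1 : opNorm W ≤ 1) :
    frobNorm (evolve (hamiltonian h) t W - trunc Y (evolve (hamiltonian h) t W)) ≤
      6 * gTilde h k J₀ lam g * t *
        Real.sqrt (∑ i ∈ X, ∑ j ∈ Yᶜ, (((G.dist i j : ℝ) + 1) ^ (-α)) ^ 2) := by
  obtain ⟨i₀, -⟩ := hXne
  set H := hamiltonian h with hH
  -- With this choice `H₀` commutes with `W`, and every Pauli product in `H - H₀` acts somewhere on
  -- `X`.
  set H₀ := trunc Xᶜ H with hH₀
  set Gt := gTilde h k J₀ lam g with hGt
  set J := pauliBase h ^ ((k : ℝ) / 2) * J₀ with hJ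
  have hJ0 : 0 ≤ J := mul_nonneg (Real.rpow_nonneg (zero_le_one.trans (one_le_pauliBase h)) _)
    (nonneg_of_isPowerLaw i₀ hP)
  have hl1 := one_le_of_isConvConst i₀ hl
  have hlG : lam * J ≤ Gt := le_max_right _ _
  have hgG : g * k ≤ Gt := le_max_left _ _
  have hJG : J ≤ Gt := (le_mul_of_one_le_left hJ0 hl1).trans hlG
  have hG0 : 0 ≤ Gt := hJ0.trans hJG
  have hHh := isHermitian_hamiltonian hP
  set S := ∑ i ∈ X, ∑ j ∈ Yᶜ, (((G.dist i j : ℝ) + 1) ^ (-α)) ^ 2 with hS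
  have hmono := norm_pauliCoeff_trunc_le Xᶜ H
  have hleak : ∀ s, 0 ≤ s → s ≤ t →
      frobNorm (evolve H₀ s (H - H₀) - trunc Y (evolve H₀ s (H - H₀))) ≤
        3 * Gt * Real.sqrt S := by
    intro s hs0 hst
    have hx : Real.exp 1 * (2 * Gt * s) < 1 := by
      refine lt_of_le_of_lt ?_ hsmall
      have : Real.exp 1 * (2 * Gt * s) = 2 * Real.exp 1 * Gt * s := by ring
      rw [this]
      have : 0 ≤ 2 * Real.exp 1 * Gt := by positivity
      gcongr
    have hGs : 2 * Gt * s < 1 := by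
      have h1 : 1 ≤ Real.exp 1 := by linarith [Real.exp_one_gt_d9]
      have h2 : 0 ≤ 2 * Gt * s := by positivity
      nlinarith
    have hden := one_sub_sq_bound hx
    -- Evolution under `H₀`, which is supported off `X`, commutes with truncation to `Xᶜ`. The
    -- evolved perturbation thus still consists of Pauli products that touch `X`.
    have htr : trunc Xᶜ (evolve H₀ s (H - H₀)) = 0 := by
      rw [trunc_evolve (supportedOn_trunc _ _), map_sub, hH₀,
        trunc_eq_self (supportedOn_trunc _ _), sub_self]
      simp [evolve]
    have hpair : ∀ i ∈ X, ∀ j, pairNorm i j (evolve H₀ s (H - H₀)) ≤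
        3 * Gt * ((G.dist i j : ℝ) + 1) ^ (-α) := by
      intro i hi j
      have h1 := pairNorm_evolve_le (B := H₀) (V := H - H₀) (i := i) (k := k) (g := g) (J := J)
        (lam := lam) (G := Gt) (φ := fun i j => ((G.dist i j : ℝ) + 1) ^ (-α))
        (by
          intro p hp
          rw [hH₀, pauliCoeff_trunc, if_neg]
          exact fun h' => Finset.mem_compl.1 (h' (mem_psupp.2 hp)) hi)
        ((degreeLE_hamiltonian hP).mono hmono)
        ((degreeLE_hamiltonian hP).mono (norm_pauliCoeff_sub_trunc_le Xᶜ H))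
        (fun l => (Finset.sum_le_sum fun p _ =>
          mul_le_mul_of_nonneg_right (hmono p) (act_nonneg p l)).trans
            (sum_pauliCoeff_hamiltonian_act_le hP hg l))
        (fun l j => (pairNorm_mono hmono l j).trans (pairNorm_hamiltonian_le hP l j))
        (fun j => (pairNorm_mono (norm_pauliCoeff_sub_trunc_le Xᶜ H) i j).trans
          (pairNorm_hamiltonian_le hP i j))
        hJ0 (fun l j => by positivity) (fun j => hl i j) hgG hlG hG0 hs0 hGs j
      refine h1.trans ?_
      have hφ : 0 ≤ ((G.dist i j : ℝ) + 1) ^ (-α) := by positivity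
      rw [div_le_iff₀ (by linarith)]
      have h2 : J * ((G.dist i j : ℝ) + 1) ^ (-α) ≤ Gt * ((G.dist i j : ℝ) + 1) ^ (-α) :=
        mul_le_mul_of_nonneg_right hJG hφ
      have h3 : 0 ≤ Gt * ((G.dist i j : ℝ) + 1) ^ (-α) := mul_nonneg hG0 hφ
      nlinarith
    have h3 := frobNorm_sub_trunc_sq_le (Y := Y) htr
    have h4 : ∑ i ∈ X, ∑ j ∈ Yᶜ, pairNorm i j (evolve H₀ s (H - H₀)) ^ 2 ≤ (3 * Gt) ^ 2 * S := by
      rw [hS, Finset.mul_sum]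
      refine Finset.sum_le_sum fun i hi => ?_
      rw [Finset.mul_sum]
      refine Finset.sum_le_sum fun j _ => ?_
      rw [← mul_pow]
      exact pow_le_pow_left₀ (pairNorm_nonneg _ _ _) (hpair i hi j) 2
    have h5 := Real.sqrt_le_sqrt (h3.trans h4)
    rwa [Real.sqrt_sq (frobNorm_nonneg _), Real.sqrt_mul (sq_nonneg _),
      Real.sqrt_sq (by positivity)] at h5
  refine (frobNorm_evolve_sub_trunc_le hHh (isHermitian_trunc hHh _) (supportedOn_trunc _ _) hW
    hXY hW1 ht (by positivity) hleak).trans_eq ?_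
  ring

end Coefficients

/-! ### Power-law sums on the lattice. -/

section Geometry

/-- The right side is the integral of `y ^ (-(s + 1))` over `[x, x + 1]`, in a form that telescopes.
Two uses of `1 + u ≤ exp u` replace the integral. -/
lemma rpow_neg_succ_le {x s : ℝ} (hx : 0 < x) (hs : 0 < s) :
    (x + 1) ^ (-(s + 1)) ≤ (x ^ (-s) - (x + 1) ^ (-s)) / s := by
  have hy : 0 < x + 1 := by linarith
  rw [le_div_iff₀ hs]
  have h1 : (x + 1) ^ (-(s + 1)) = (x + 1) ^ (-s) / (x + 1) := by
    rw [neg_add, ← sub_eq_add_neg, Real.rpow_sub_one hy.ne']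
  have h2 : x ^ (-s) = (x + 1) ^ (-s) * (x / (x + 1)) ^ (-s) := by
    rw [← Real.mul_rpow hy.le (by positivity), mul_div_cancel₀ _ hy.ne']
  have h3 : 1 + s / (x + 1) ≤ (x / (x + 1)) ^ (-s) := by
    have h4 : x / (x + 1) ≤ Real.exp (-(1 / (x + 1))) := by
      have := Real.add_one_le_exp (-(1 / (x + 1)))
      refine le_trans (le_of_eq ?_) this
      field_simp
      ring
    calc 1 + s / (x + 1) ≤ Real.exp (s / (x + 1)) := by
          have := Real.add_one_le_exp (s / (x + 1)); linarith
      _ = (Real.exp (-(1 / (x + 1)))) ^ (-s) := by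
          rw [← Real.exp_mul]; congr 1; field_simp
      _ ≤ (x / (x + 1)) ^ (-s) :=
          Real.rpow_le_rpow_of_nonpos (by positivity) h4 (by linarith)
  rw [h1, h2]
  have h5 : 0 < (x + 1) ^ (-s) := by positivity
  calc (x + 1) ^ (-s) / (x + 1) * s = (x + 1) ^ (-s) * (1 + s / (x + 1)) - (x + 1) ^ (-s) := by
        field_simp; ring
    _ ≤ _ := by gcongr

/-- The tail of a power series, compared with the integral. -/
lemma sum_range_rpow_le {s b : ℝ} (hs : 0 < s) (hb : 0 < b) (n : ℕ) :
    ∑ u ∈ Finset.range n, (b + u + 1) ^ (-(s + 1)) ≤ b ^ (-s) / s := by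
  have h : ∑ u ∈ Finset.range n, (b + u + 1) ^ (-(s + 1)) ≤
      (b ^ (-s) - (b + n) ^ (-s)) / s := by
    induction n with
    | zero => simp
    | succ n ih =>
      rw [Finset.sum_range_succ]
      have h1 := rpow_neg_succ_le (x := b + n) (by positivity) hs
      push_cast
      rw [show b + ((n : ℝ) + 1) = b + n + 1 by ring]
      calc _ ≤ (b ^ (-s) - (b + n) ^ (-s)) / s + ((b + n) ^ (-s) - (b + n + 1) ^ (-s)) / s :=
            add_le_add ih h1
        _ = _ := by ring
  refine h.trans ?_
  gcongr
  have : 0 ≤ (b + n) ^ (-s) := by positivity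
  linarith

variable {Λ : Type*} [Fintype Λ] [DecidableEq Λ] {G : SimpleGraph Λ} {D : ℕ} {γ : ℝ}

/-- The power-law sum over the sites at distance more than `b`. -/
lemma sum_far_le (hD : 1 ≤ D) (hG : IsLattice G D γ) {s : ℝ} (hs : 0 < s) (a : Λ) (b : ℕ) :
    ∑ j ∈ Finset.univ.filter (fun j => b < G.dist a j), ((G.dist a j : ℝ) + 1) ^ (-(s + D)) ≤
      γ * ((b : ℝ) + 1) ^ (-s) / s := by
  have hγ : 0 ≤ γ := zero_le_one.trans hG.one_le
  let N := Finset.univ.sup (fun j => G.dist a j)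
  have hmaps : ∀ j ∈ Finset.univ.filter (fun j => b < G.dist a j),
      G.dist a j - (b + 1) ∈ Finset.range (N + 1) := by
    intro j _
    have : G.dist a j ≤ N := Finset.le_sup (f := fun j => G.dist a j) (Finset.mem_univ j)
    rw [Finset.mem_range]; omega
  rw [← Finset.sum_fiberwise_of_maps_to hmaps]
  calc _ ≤ ∑ u ∈ Finset.range (N + 1), γ * ((b : ℝ) + 1 + u + 1) ^ (-(s + 1)) := by
        refine Finset.sum_le_sum fun u _ => ?_
        have hval : ∀ j ∈ (Finset.univ.filter (fun j => b < G.dist a j)).filter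
            (fun j => G.dist a j - (b + 1) = u), ((G.dist a j : ℝ) + 1) ^ (-(s + D)) =
            ((b : ℝ) + 1 + u + 1) ^ (-(s + D)) := by
          intro j hj
          simp only [Finset.mem_filter, Finset.mem_univ, true_and] at hj
          have : G.dist a j = b + 1 + u := by omega
          rw [this]; push_cast; rfl
        rw [Finset.sum_congr rfl hval, Finset.sum_const, nsmul_eq_mul]
        have hsub : (Finset.univ.filter (fun j => b < G.dist a j)).filter
            (fun j => G.dist a j - (b + 1) = u) ⊆ sphere G a (b + 1 + u) := by
          intro j hj
          simp only [Finset.mem_filter, Finset.mem_univ, true_and] at hj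
          simp only [sphere, Finset.mem_filter, Finset.mem_univ, true_and]
          omega
        -- A shell has at most `γ` times its radius to the power `D - 1` sites. Enlarging the radius
        -- by one matches the base of the summand, and the exponents combine to `-(s + 1)`.
        have hcard : ((((Finset.univ.filter (fun j => b < G.dist a j)).filter
            (fun j => G.dist a j - (b + 1) = u)).card : ℕ) : ℝ) ≤
            γ * ((b : ℝ) + 1 + u + 1) ^ ((D : ℝ) - 1) := by
          refine (Nat.cast_le.2 (Finset.card_le_card hsub)).trans ?_
          refine (hG.card_sphere a (b + 1 + u) (by omega)).trans ?_
          rw [show (D : ℝ) - 1 = ((D - 1 : ℕ) : ℝ) by rw [Nat.cast_sub hD]; simp,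
            Real.rpow_natCast]
          push_cast
          exact mul_le_mul_of_nonneg_left
            (pow_le_pow_left₀ (by positivity) (by linarith) _) hγ
        have hpos : (0 : ℝ) < (b : ℝ) + 1 + u + 1 := by positivity
        refine (mul_le_mul_of_nonneg_right hcard (by positivity)).trans_eq ?_
        rw [mul_assoc, ← Real.rpow_add hpos]
        congr 2
        ring
    _ ≤ γ * (((b : ℝ) + 1) ^ (-s) / s) := by
        rw [← Finset.mul_sum]
        exact mul_le_mul_of_nonneg_left (sum_range_rpow_le hs (by positivity) _) hγ
    _ = _ := by ring

/-- The squared power law summed over the pairs of a site in a ball and a site at distance more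
than `δ` from the ball. -/
lemma sum_ball_far_le (hD : 1 ≤ D) (hG : IsLattice G D γ) {α : ℝ} (hα : (D : ℝ) < α) (i : Λ)
    {r δ R : ℕ} (hδ : 1 ≤ δ) (hR : r + δ ≤ R) :
    ∑ a ∈ ball G i r, ∑ j ∈ (ball G i (r + δ))ᶜ, (((G.dist a j : ℝ) + 1) ^ (-α)) ^ 2 ≤
      γ ^ 2 * (R : ℝ) ^ ((D : ℝ) - 1) * (δ : ℝ) ^ (-(2 * α - D - 1)) /
        ((2 * α - D) * (2 * α - D - 1)) := by
  have hD' : (1 : ℝ) ≤ D := by exact_mod_cast hD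
  have hγ : 0 ≤ γ := zero_le_one.trans hG.one_le
  have hs : 0 < 2 * α - D - 1 := by linarith
  have hs1 : 0 < 2 * α - D := by linarith
  have hR1 : (1 : ℝ) ≤ R := by exact_mod_cast (by omega : 1 ≤ R)
  -- A site at depth `r - G.dist i a` inside the ball is farther than this depth plus `δ` from every
  -- `j` outside. Summing over `j` costs `D` powers of the `2α`.
  have hinner : ∀ a ∈ ball G i r, ∑ j ∈ (ball G i (r + δ))ᶜ, (((G.dist a j : ℝ) + 1) ^ (-α)) ^ 2 ≤
      γ * (((r - G.dist i a : ℕ) : ℝ) + δ + 1) ^ (-(2 * α - D)) / (2 * α - D) := by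
    intro a ha
    have ha' : G.dist i a ≤ r := by simpa [ball] using ha
    have h1 := sum_far_le hD hG hs1 a (r - G.dist i a + δ)
    push_cast at h1
    refine le_trans ?_ h1
    have hexp : ∀ j, (((G.dist a j : ℝ) + 1) ^ (-α)) ^ 2 =
        ((G.dist a j : ℝ) + 1) ^ (-(2 * α - D + D)) := by
      intro j
      rw [← Real.rpow_natCast, ← Real.rpow_mul (by positivity)]
      congr 1; push_cast; ring
    simp only [hexp]
    refine Finset.sum_le_sum_of_subset_of_nonneg ?_ fun j _ _ => by positivity
    intro j hj
    simp only [ball, Finset.mem_compl, Finset.mem_filter, Finset.mem_univ, true_and, not_le] at hj ⊢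
    have := hG.connected.dist_triangle (u := i) (v := a) (w := j)
    omega
  refine (Finset.sum_le_sum hinner).trans ?_
  have hmaps : ∀ a ∈ ball G i r, r - G.dist i a ∈ Finset.range (r + 1) := by
    intro a _
    rw [Finset.mem_range]; omega
  -- Sites are grouped by depth. Each layer has at most `γ * R ^ (D - 1)` sites, and the sum over
  -- depths costs one further power.
  rw [← Finset.sum_fiberwise_of_maps_to hmaps]
  calc _ ≤ ∑ l ∈ Finset.range (r + 1), (γ * (R : ℝ) ^ ((D : ℝ) - 1)) *
        (γ / (2 * α - D) * ((δ : ℝ) + l + 1) ^ (-((2 * α - D - 1) + 1))) := by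
        refine Finset.sum_le_sum fun l hl => ?_
        have hl' : l ≤ r := by rw [Finset.mem_range] at hl; omega
        have hval : ∀ a ∈ (ball G i r).filter (fun a => r - G.dist i a = l),
            γ * (((r - G.dist i a : ℕ) : ℝ) + δ + 1) ^ (-(2 * α - D)) / (2 * α - D) =
            γ / (2 * α - D) * ((δ : ℝ) + l + 1) ^ (-((2 * α - D - 1) + 1)) := by
          intro a ha
          rw [(Finset.mem_filter.1 ha).2, sub_add_cancel, add_comm (l : ℝ)]
          ring
        rw [Finset.sum_congr rfl hval, Finset.sum_const, nsmul_eq_mul]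
        refine mul_le_mul_of_nonneg_right ?_ (by positivity)
        have hsub : (ball G i r).filter (fun a => r - G.dist i a = l) ⊆ sphere G i (r - l) := by
          intro a ha
          simp only [ball, sphere, Finset.mem_filter, Finset.mem_univ, true_and] at ha ⊢
          omega
        refine (Nat.cast_le.2 (Finset.card_le_card hsub)).trans ?_
        rw [show (D : ℝ) - 1 = ((D - 1 : ℕ) : ℝ) by rw [Nat.cast_sub hD]; simp,
          Real.rpow_natCast]
        -- The lattice bound on spheres starts at radius one, so the centre is counted separately.
        rcases Nat.eq_zero_or_pos (r - l) with h0 | h0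
        · rw [h0]
          have : sphere G i 0 ⊆ {i} := by
            intro a ha
            simp only [sphere, Finset.mem_filter, Finset.mem_univ, true_and] at ha
            rw [hG.connected.dist_eq_zero_iff] at ha
            simp [ha]
          have h1 : ((sphere G i 0).card : ℝ) ≤ 1 := by
            exact_mod_cast (Finset.card_le_card this).trans (by simp)
          refine h1.trans (one_le_mul_of_one_le_of_one_le hG.one_le (one_le_pow₀ hR1))
        · refine (hG.card_sphere i (r - l) h0).trans ?_
          gcongr
          omega
    _ = (γ * (R : ℝ) ^ ((D : ℝ) - 1)) * (γ / (2 * α - D)) *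
        ∑ l ∈ Finset.range (r + 1), ((δ : ℝ) + l + 1) ^ (-((2 * α - D - 1) + 1)) := by
        rw [Finset.mul_sum]
        exact Finset.sum_congr rfl fun l _ => by ring
    _ ≤ (γ * (R : ℝ) ^ ((D : ℝ) - 1)) * (γ / (2 * α - D)) *
        ((δ : ℝ) ^ (-(2 * α - D - 1)) / (2 * α - D - 1)) := by
        refine mul_le_mul_of_nonneg_left (sum_range_rpow_le hs (by positivity) _) (by positivity)
    _ = _ := by
        field_simp

/-- A convolution constant that depends on the lattice parameters only. -/
lemma isConvConst_of_isLattice (hD : 1 ≤ D) (hG : IsLattice G D γ) {α : ℝ} (hα : (D : ℝ) < α) :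
    IsConvConst G α ((2 : ℝ) ^ (α + 1) * (1 + γ / (α - D))) := by
  have hα0 : 0 < α := lt_of_le_of_lt (Nat.cast_nonneg D) hα
  have hsum : ∀ a : Λ, ∑ j, ((G.dist a j : ℝ) + 1) ^ (-α) ≤ 1 + γ / (α - D) := by
    intro a
    have h1 := sum_far_le hD hG (s := α - D) (by linarith) a 0
    rw [sub_add_cancel, Nat.cast_zero, zero_add, Real.one_rpow, mul_one] at h1
    rw [← Finset.sum_filter_add_sum_filter_not Finset.univ (fun j => 0 < G.dist a j), add_comm]
    refine add_le_add ?_ h1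
    have hsub : Finset.univ.filter (fun j => ¬ 0 < G.dist a j) ⊆ {a} := by
      intro j hj
      simp only [Finset.mem_filter, Finset.mem_univ, true_and, not_lt, Nat.le_zero] at hj
      rw [hG.connected.dist_eq_zero_iff] at hj
      simp [hj]
    refine (Finset.sum_le_sum_of_subset_of_nonneg hsub fun j _ _ => by positivity).trans ?_
    simp
  intro i i'
  set d := ((G.dist i i' : ℝ) + 1) ^ (-α) with hd
  -- By the triangle inequality the larger of the two shifted distances is at least half of the
  -- shifted distance between `i` and `i'`. That factor yields `2 ^ α * d`; the other one remains to
  -- be summed.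
  have hpt : ∀ j, ((G.dist i j : ℝ) + 1) ^ (-α) * ((G.dist j i' : ℝ) + 1) ^ (-α) ≤
      (2 : ℝ) ^ α * d * (((G.dist i j : ℝ) + 1) ^ (-α) + ((G.dist i' j : ℝ) + 1) ^ (-α)) := by
    intro j
    have htri : (G.dist i i' : ℝ) ≤ G.dist i j + G.dist j i' := by
      exact_mod_cast hG.connected.dist_triangle
    rw [G.dist_comm (u := i') (v := j)]
    have hhalf : ∀ x : ℝ, ((G.dist i i' : ℝ) + 1) / 2 ≤ x → x ^ (-α) ≤ (2 : ℝ) ^ α * d := by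
      intro x hx
      refine (Real.rpow_le_rpow_of_nonpos (by positivity) hx (by linarith)).trans_eq ?_
      rw [hd, Real.div_rpow (by positivity) (by norm_num), Real.rpow_neg (by norm_num : (0:ℝ) ≤ 2),
        div_inv_eq_mul, mul_comm]
    have p1 : 0 ≤ ((G.dist i j : ℝ) + 1) ^ (-α) := by positivity
    have p2 : 0 ≤ ((G.dist j i' : ℝ) + 1) ^ (-α) := by positivity
    have p3 : 0 ≤ (2 : ℝ) ^ α * d := by positivity
    rcases le_total (G.dist i j : ℝ) (G.dist j i') with hle | hle
    · have := hhalf ((G.dist j i' : ℝ) + 1) (by linarith)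
      nlinarith
    · have := hhalf ((G.dist i j : ℝ) + 1) (by linarith)
      nlinarith
  refine (Finset.sum_le_sum fun j _ => hpt j).trans ?_
  rw [← Finset.mul_sum, Finset.sum_add_distrib, Real.rpow_add_one (by norm_num)]
  have h3 : 0 ≤ (2 : ℝ) ^ α * d := by positivity
  calc (2 : ℝ) ^ α * d * (∑ j, ((G.dist i j : ℝ) + 1) ^ (-α) + ∑ j, ((G.dist i' j : ℝ) + 1) ^ (-α))
      ≤ (2 : ℝ) ^ α * d * ((1 + γ / (α - D)) + (1 + γ / (α - D))) :=
        mul_le_mul_of_nonneg_left (add_le_add (hsum i) (hsum i')) h3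
    _ = _ := by ring

end Geometry

/-! ### Local approximation by iterated short steps. -/

section Approximation

variable {Λ : Type*} [Fintype Λ] [DecidableEq Λ] {G : SimpleGraph Λ} {h : Finset Λ → Op Λ}
  {D k : ℕ} {α γ J₀ : ℝ}

lemma ball_mono (G : SimpleGraph Λ) (i : Λ) {r s : ℕ} (hrs : r ≤ s) : ball G i r ⊆ ball G i s := by
  intro j hj
  simp only [ball, Finset.mem_filter, Finset.mem_univ, true_and] at hj ⊢
  omega

lemma mem_ball_self (G : SimpleGraph Λ) (i : Λ) (r : ℕ) : i ∈ ball G i r := by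
  simp [ball]

lemma gTilde_nonneg (i : Λ) (hP : IsPowerLaw G h k α J₀) {lam g : ℝ} (hl : IsConvConst G α lam) :
    0 ≤ gTilde h k J₀ lam g := by
  refine le_max_of_le_right (mul_nonneg ?_ (mul_nonneg ?_ (nonneg_of_isPowerLaw i hP)))
  · exact zero_le_one.trans (one_le_of_isConvConst i hl)
  · exact Real.rpow_nonneg (zero_le_one.trans (one_le_pauliBase h)) _

/-- The error of one time step, for balls. -/
lemma frobNorm_time_step_ball_le (hD : 1 ≤ D) (hα : (D : ℝ) < α) (hG : IsLattice G D γ)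
    (hP : IsPowerLaw G h k α J₀) {lam g t : ℝ} (hl : IsConvConst G α lam)
    (hg : IsSiteEnergy h g) (ht : 0 ≤ t) (hsmall : 2 * Real.exp 1 * gTilde h k J₀ lam g * t < 1)
    (i : Λ) {r δ R : ℕ} (hδ : 1 ≤ δ) (hR : r + δ ≤ R) {W : Op Λ} (hW : SupportedOn (ball G i r) W)
    (hW1 : opNorm W ≤ 1) :
    frobNorm (evolve (hamiltonian h) t W -
        trunc (ball G i (r + δ)) (evolve (hamiltonian h) t W)) ≤
      3 * gTilde h k J₀ lam g * γ / (α - D) * t *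
        ((R : ℝ) ^ (((D : ℝ) - 1) / 2) * (δ : ℝ) ^ (-α + ((D : ℝ) + 1) / 2)) := by
  have hD' : (1 : ℝ) ≤ D := by exact_mod_cast hD
  have hγ : 0 ≤ γ := zero_le_one.trans hG.one_le
  have hg0 := gTilde_nonneg (g := g) i hP hl
  have hαD : 0 < α - D := by linarith
  refine (frobNorm_time_step_le hP hl hg ht hsmall (ball_mono G i (by omega : r ≤ r + δ))
    ⟨i, mem_ball_self G i r⟩ hW hW1).trans ?_
  have h1 := sum_ball_far_le hD hG hα i hδ hR
  -- Because `D ≥ 1`, both factors of the denominator are at least `2 * (α - D)`, which makes the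
  -- bound a perfect square.
  have h2 : γ ^ 2 * (R : ℝ) ^ ((D : ℝ) - 1) * (δ : ℝ) ^ (-(2 * α - D - 1)) /
        ((2 * α - D) * (2 * α - D - 1)) ≤ (γ / (2 * (α - D)) *
        ((R : ℝ) ^ (((D : ℝ) - 1) / 2) * (δ : ℝ) ^ (-α + ((D : ℝ) + 1) / 2))) ^ 2 := by
    rw [mul_pow, mul_pow, div_pow, ← Real.rpow_mul_natCast (Nat.cast_nonneg R),
      ← Real.rpow_mul_natCast (Nat.cast_nonneg δ)]
    have e1 : ((D : ℝ) - 1) / 2 * (2 : ℕ) = D - 1 := by push_cast; ring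
    have e2 : (-α + ((D : ℝ) + 1) / 2) * (2 : ℕ) = -(2 * α - D - 1) := by push_cast; ring
    rw [e1, e2, div_mul_eq_mul_div, ← mul_assoc]
    refine div_le_div_of_nonneg_left (by positivity) (by positivity) ?_
    nlinarith
  have h3 := Real.sqrt_le_sqrt (h1.trans h2)
  rw [Real.sqrt_sq (by positivity)] at h3
  refine (mul_le_mul_of_nonneg_left h3 (by positivity)).trans_eq ?_
  field_simp
  ring

/-- The local approximation after `n` time steps. -/
lemma exists_local_approximation_steps (hD : 1 ≤ D) (hα : (D : ℝ) < α) (hG : IsLattice G D γ)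
    (hP : IsPowerLaw G h k α J₀) {lam g t : ℝ} (hl : IsConvConst G α lam)
    (hg : IsSiteEnergy h g) (ht : 0 ≤ t) (hsmall : 2 * Real.exp 1 * gTilde h k J₀ lam g * t < 1)
    (i : Λ) {δ R m : ℕ} (hδ : 1 ≤ δ) (hR : m * δ ≤ R) {W : Op Λ} (hW : SupportedOn {i} W)
    (hW1 : opNorm W ≤ 1) (n : ℕ) (hn : n ≤ m) :
    ∃ W' : Op Λ, SupportedOn (ball G i (n * δ)) W' ∧ opNorm W' ≤ 1 ∧
      frobNorm (evolve (hamiltonian h) (n * t) W - W') ≤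
        n * (3 * gTilde h k J₀ lam g * γ / (α - D) * t *
        ((R : ℝ) ^ (((D : ℝ) - 1) / 2) * (δ : ℝ) ^ (-α + ((D : ℝ) + 1) / 2))) := by
  induction n with
  | zero =>
    refine ⟨W, hW.mono (by simp [mem_ball_self]), hW1, ?_⟩
    simp [evolve_zero_time, frobNorm_zero]
  | succ n ih =>
    obtain ⟨W₁, hs, ho, hf⟩ := ih (by omega)
    have hH := isHermitian_hamiltonian hP
    have hR' : n * δ + δ ≤ R := by
      have := Nat.mul_le_mul_right δ hn
      rw [Nat.succ_mul] at this
      omega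
    have hstep := frobNorm_time_step_ball_le hD hα hG hP hl hg ht hsmall i hδ hR' hs ho
    -- The old error passes through the evolution without growing in Frobenius norm, and the new
    -- truncation adds the error of one step.
    refine ⟨trunc (ball G i (n * δ + δ)) (evolve (hamiltonian h) t W₁), ?_, ?_, ?_⟩
    · rw [Nat.succ_mul]
      exact supportedOn_trunc _ _
    · exact (opNorm_trunc_le _ _).trans ((opNorm_evolve_le _ hH _ _).trans ho)
    · have h1 : evolve (hamiltonian h) (((n + 1 : ℕ) : ℝ) * t) W =
          evolve (hamiltonian h) t (evolve (hamiltonian h) (n * t) W) := by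
        rw [← evolve_add_time]; push_cast; ring_nf
      have h2 := frobNorm_add_le (evolve (hamiltonian h) t (evolve (hamiltonian h) (n * t) W - W₁))
        (evolve (hamiltonian h) t W₁ -
          trunc (ball G i (n * δ + δ)) (evolve (hamiltonian h) t W₁))
      have h3 := (frobNorm_evolve_le _ hH t (evolve (hamiltonian h) (n * t) W - W₁)).trans hf
      rw [evolve_sub] at h2 h3
      rw [sub_add_sub_cancel, ← h1] at h2
      rw [← h1] at h3
      push_cast at h2 h3 ⊢
      linarith

/-- The local approximation of an evolved one-site operator. -/
lemma exists_local_approximation (hD : 1 ≤ D) (hα : (D : ℝ) < α) (hG : IsLattice G D γ)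
    (hP : IsPowerLaw G h k α J₀) {lam g t Δt : ℝ} (hl : IsConvConst G α lam)
    (hg : IsSiteEnergy h g) (ht : 0 < t) (hΔ : 0 < Δt)
    (hsmall : 2 * Real.exp 1 * gTilde h k J₀ lam g * Δt < 1) {m R : ℕ} (hm : t / Δt = m)
    (hR : 0 < R) (hmR : m ∣ R) (i : Λ) {W : Op Λ} (hW : SupportedOn {i} W) (hW1 : opNorm W ≤ 1) :
    ∃ W' : Op Λ, SupportedOn (ball G i R) W' ∧
      frobNorm (evolve (hamiltonian h) t W - W') ≤ 3 * gTilde h k J₀ lam g * γ / (α - D) *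
        Δt ^ (-α + ((D : ℝ) + 1) / 2) * t ^ (α - ((D : ℝ) - 1) / 2) * (R : ℝ) ^ (-α + D) := by
  obtain ⟨δ, rfl⟩ := hmR
  have hδ : 1 ≤ δ := Nat.pos_of_mul_pos_left hR
  have hmt : (m : ℝ) * Δt = t := by rw [← hm]; field_simp
  obtain ⟨W', hs, -, hf⟩ := exists_local_approximation_steps hD hα hG hP hl hg hΔ.le hsmall i hδ
    le_rfl hW hW1 m le_rfl
  refine ⟨W', hs, ?_⟩
  rw [hmt] at hf
  refine hf.trans_eq ?_
  have hR' : (0 : ℝ) < ((m * δ : ℕ) : ℝ) := by exact_mod_cast hR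
  -- With `m * Δt = t` the shell width is expressed through `R`, `Δt` and `t`; the number of steps
  -- times `Δt` supplies one more factor `t`.
  have hδ' : (δ : ℝ) = ((m * δ : ℕ) : ℝ) * Δt / t := by
    push_cast
    rw [← hmt]
    have hm0 : (m : ℝ) ≠ 0 := by
      intro h0; rw [h0, zero_mul] at hmt; exact ht.ne hmt
    field_simp
  generalize ((m * δ : ℕ) : ℝ) = R at *
  have e1 : (δ : ℝ) ^ (-α + ((D : ℝ) + 1) / 2) = R ^ (-α + ((D : ℝ) + 1) / 2) *
      Δt ^ (-α + ((D : ℝ) + 1) / 2) * t ^ (α - ((D : ℝ) + 1) / 2) := by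
    rw [hδ', Real.div_rpow (by positivity) ht.le, Real.mul_rpow hR'.le hΔ.le, div_eq_mul_inv,
      ← Real.rpow_neg ht.le]
    congr 2
    ring
  have e2 : R ^ (-α + (D : ℝ)) = R ^ (((D : ℝ) - 1) / 2) * R ^ (-α + ((D : ℝ) + 1) / 2) := by
    rw [← Real.rpow_add hR']; congr 1; ring
  have e3 : t ^ (α - ((D : ℝ) - 1) / 2) = t * t ^ (α - ((D : ℝ) + 1) / 2) := by
    rw [← Real.rpow_one_add' ht.le]
    · congr 1; ring
    · have : (1 : ℝ) ≤ D := by exact_mod_cast hD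
      intro h0; linarith
  rw [e1, e2, e3, ← hmt]
  ring

/-- The second term of `C₀` already suffices: its power of two and its square root are at least one,
and `3 ≤ 80`. -/
lemma three_mul_div_le_C₀ (hD : 1 ≤ D) (hα : (D : ℝ) < α) (hγ : 1 ≤ γ) (hJ : 0 ≤ J₀) {gt : ℝ}
    (hgt : 0 ≤ gt) : 3 * gt * γ / (α - D) ≤ (2 : ℝ) ^ (D - 1) * C₀ D α γ J₀ gt := by
  have hD' : (1 : ℝ) ≤ D := by exact_mod_cast hD
  have hαD : 0 < α - D := by linarith
  have h1 : 0 ≤ (2 : ℝ) ^ (α - (D : ℝ) / 2 + 2) * J₀ * γ / (2 * α - D - 1) :=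
    div_nonneg (by positivity) (by linarith)
  have h2 : 1 ≤ (2 : ℝ) ^ (α - (D : ℝ) / 2) := Real.one_le_rpow (by norm_num) (by linarith)
  have h3 : 1 ≤ Real.sqrt (2 * α - 2 * D + γ) := Real.one_le_sqrt.2 (by linarith)
  have h4 : 3 * gt * γ / (α - D) ≤ 80 * gt * γ * (2 : ℝ) ^ (α - (D : ℝ) / 2) / (α - D) *
      Real.sqrt (2 * α - 2 * D + γ) := by
    calc 3 * gt * γ / (α - D) = 3 * gt * γ * 1 / (α - D) * 1 := by ring
      _ ≤ _ := by gcongr; norm_num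
  have h5 : (1 : ℝ) ≤ 2 ^ (D - 1) := one_le_pow₀ (by norm_num)
  have h6 : 3 * gt * γ / (α - D) ≤ C₀ D α γ J₀ gt := by rw [C₀]; linarith
  exact h6.trans (le_mul_of_one_le_left ((by positivity : 0 ≤ 3 * gt * γ / (α - D)).trans h6) h5)

end Approximation

/-! ### From local approximations to the out-of-time-order correlator. -/

section Otoc

variable {Λ : Type*} [Fintype Λ] [DecidableEq Λ]

/-- The OTOC is controlled by the error of an approximation that commutes with `V`. -/
lemma otoc_le_of_commute {H W V W' : Op Λ} {t : ℝ} (hV : opNorm V ≤ 1) (hc : W' * V = V * W') :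
    otoc H t W V ≤ 4 * frobNorm (evolve H t W - W') ^ 2 := by
  have h1 : otoc H t W V = frobNorm (evolve H t W * V - V * evolve H t W) ^ 2 := by
    rw [otoc, frobNorm_sq, ntr_conjTranspose_mul_self, Complex.ofReal_re]
  have h2 : evolve H t W * V - V * evolve H t W =
      (evolve H t W - W') * V - V * (evolve H t W - W') := by
    rw [sub_mul, mul_sub, hc]; abel
  have h3 := frobNorm_commutator_le (evolve H t W - W') V
  have h4 : frobNorm (evolve H t W * V - V * evolve H t W) ≤ 2 * frobNorm (evolve H t W - W') := by
    rw [h2]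
    exact h3.trans (mul_le_of_le_one_right (by have := frobNorm_nonneg (evolve H t W - W'); linarith)
      hV)
  rw [h1]
  refine (pow_le_pow_left₀ (frobNorm_nonneg _) h4 2).trans_eq ?_
  ring

lemma otoc_le_of_ball {G : SimpleGraph Λ} {H W V W' : Op Λ} {t : ℝ} {i i' : Λ} {r : ℕ}
    (hr : r < G.dist i i') (hV : SupportedOn {i'} V) (hV1 : opNorm V ≤ 1)
    (hW' : SupportedOn (ball G i r) W') :
    otoc H t W V ≤ 4 * frobNorm (evolve H t W - W') ^ 2 := by
  refine otoc_le_of_commute hV1 (hW'.commute hV ?_)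
  rw [Finset.disjoint_singleton_right]
  simp only [ball, Finset.mem_filter, Finset.mem_univ, true_and]
  omega

end Otoc

/-! ### Bounds with constants independent of the system. -/

section Uniform

/-- The decay condition with both sites equal bounds the total norm of the terms at a site. This
provides a `g` that depends on `k` and `J₀` only. -/
lemma isSiteEnergy_of_isPowerLaw {Λ : Type*} [Fintype Λ] [DecidableEq Λ] {G : SimpleGraph Λ}
    {h : Finset Λ → Op Λ} {k : ℕ} {α J₀ : ℝ} (hP : IsPowerLaw G h k α J₀) :
    IsSiteEnergy h ((4 : ℝ) ^ ((k : ℝ) / 2) * J₀) := by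
  intro i
  have h1 := hP.decay i i
  simp only [SimpleGraph.dist_self, Nat.cast_zero, zero_add, Real.one_rpow, mul_one,
    and_self] at h1
  have hb : pauliBase h ^ ((k : ℝ) / 2) ≤ (4 : ℝ) ^ ((k : ℝ) / 2) :=
    Real.rpow_le_rpow (zero_le_one.trans (one_le_pauliBase h)) (pauliBase_le h) (by positivity)
  refine le_trans ?_ (mul_le_mul_of_nonneg_left h1 (by positivity))
  rw [Finset.mul_sum]
  refine Finset.sum_le_sum fun Z _ => ?_
  refine (Finset.sum_le_sum_of_subset_of_nonneg (Finset.filter_subset _ _)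
    fun _ _ _ => norm_nonneg _).trans ((sum_norm_pauliCoeff_term_le hP Z).trans ?_)
  exact mul_le_mul_of_nonneg_right hb (opNorm_nonneg _)

/-- For radii below `t / ε` the target bound is at least one once its constant is chosen this way,
so the zero operator is a good enough approximation there. -/
lemma one_le_rpow_of_le_div {α d ε t₀ t r : ℝ} (hd : -1 ≤ d) (hα : d < α) (hε : 0 < ε)
    (ht₀ : 0 < t₀) (ht : t₀ ≤ t) (hr : 0 < r) (hrt : r ≤ t / ε) :
    1 ≤ ε ^ (-(α - d)) * t₀ ^ (-((d + 1) / 2)) * (r ^ (-α + d) * t ^ (α - (d - 1) / 2)) := by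
  have ht0 : 0 < t := ht₀.trans_le ht
  have e1 : (t / ε) ^ (-α + d) ≤ r ^ (-α + d) :=
    Real.rpow_le_rpow_of_nonpos hr hrt (by linarith)
  have e2 : t₀ ^ ((d + 1) / 2) ≤ t ^ ((d + 1) / 2) :=
    Real.rpow_le_rpow ht₀.le ht (by linarith)
  have e3 : (t / ε) ^ (-α + d) * t ^ (α - (d - 1) / 2) = ε ^ (α - d) * t ^ ((d + 1) / 2) := by
    rw [Real.div_rpow ht0.le hε.le, div_eq_mul_inv, ← Real.rpow_neg hε.le, mul_right_comm,
      ← Real.rpow_add ht0, mul_comm]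
    congr 2 <;> ring
  have p1 : 0 < ε ^ (α - d) := by positivity
  have p2 : 0 < t₀ ^ ((d + 1) / 2) := by positivity
  have p3 : 0 < t ^ (α - (d - 1) / 2) := by positivity
  have h4 : ε ^ (α - d) * t₀ ^ ((d + 1) / 2) ≤ r ^ (-α + d) * t ^ (α - (d - 1) / 2) :=
    calc _ ≤ ε ^ (α - d) * t ^ ((d + 1) / 2) := mul_le_mul_of_nonneg_left e2 p1.le
      _ = _ := e3.symm
      _ ≤ _ := mul_le_mul_of_nonneg_right e1 p3.le
  rw [Real.rpow_neg hε.le, Real.rpow_neg ht₀.le, ← mul_inv, inv_mul_eq_div,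
    one_le_div (mul_pos p1 p2)]
  exact h4

/-- The local approximation at all radii with a constant that does not depend on the system. -/
lemma exists_uniform_local_approximation {D k : ℕ} (hD : 1 ≤ D) {α γ J₀ : ℝ} (hα : (D : ℝ) < α)
    (hγ : 1 ≤ γ) (hJ : 0 ≤ J₀) {t₀ : ℝ} (ht₀ : 0 < t₀) : ∃ C : ℝ, 0 < C ∧
      ∀ (Λ : Type u) [Fintype Λ] [DecidableEq Λ] (G : SimpleGraph Λ) (h : Finset Λ → Op Λ),
      IsLattice G D γ → IsPowerLaw G h k α J₀ →
      ∀ t : ℝ, t₀ ≤ t → ∀ (i : Λ) (W : Op Λ), SupportedOn {i} W → opNorm W = 1 →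
        ∀ r : ℕ, 1 ≤ r → ∃ W' : Op Λ, SupportedOn (ball G i r) W' ∧
          frobNorm (evolve (hamiltonian h) t W - W') ≤
            C * (r : ℝ) ^ (-α + D) * t ^ (α - ((D : ℝ) - 1) / 2) := by
  have hD' : (1 : ℝ) ≤ D := by exact_mod_cast hD
  have hαD : 0 < α - D := by linarith
  set lam : ℝ := (2 : ℝ) ^ (α + 1) * (1 + γ / (α - D)) with hlam
  have hlam0 : 0 ≤ lam := by positivity
  set B : ℝ := (4 : ℝ) ^ ((k : ℝ) / 2) * J₀ with hB
  have hB0 : 0 ≤ B := by positivity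
  -- `M` bounds `g̃` for every system with these parameters. The choice of `τ` then gives `2 * e * M
  -- * τ < 6 * (M + 1) * τ = 1`.
  set M : ℝ := max (B * k) (lam * B) with hM
  have hM0 : 0 ≤ M := le_max_of_le_right (by positivity)
  set τ : ℝ := 1 / (6 * (M + 1)) with hτ
  have hτ0 : 0 < τ := by positivity
  -- A lower bound for the step length: `⌈t / τ⌉ ≤ t / τ + 1 ≤ t / τ + t / t₀ = t / ε`. It is needed
  -- because the exponent `x` of the step length is negative.
  set ε : ℝ := 1 / (1 / τ + 1 / t₀) with hε
  have hε0 : 0 < ε := by positivity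
  set x : ℝ := -α + ((D : ℝ) + 1) / 2 with hx
  set y : ℝ := α - ((D : ℝ) - 1) / 2 with hy
  set C₁ : ℝ := 3 * M * γ / (α - D) * ε ^ x * (2 : ℝ) ^ (α - D) with hC₁
  set C₂ : ℝ := ε ^ (-(α - D)) * t₀ ^ (-(((D : ℝ) + 1) / 2)) with hC₂
  have hC₁0 : 0 ≤ C₁ := by positivity
  have hC₂0 : 0 < C₂ := by positivity
  refine ⟨C₁ + C₂, by positivity, ?_⟩
  intro Λ _ _ G h hG hP t ht i W hW hW1 r hr
  have ht0 : 0 < t := ht₀.trans_le ht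
  have hr0 : (0 : ℝ) < r := by exact_mod_cast hr
  have hpos : 0 ≤ (r : ℝ) ^ (-α + D) * t ^ y := by positivity
  have hl := isConvConst_of_isLattice hD hG hα
  have hg := isSiteEnergy_of_isPowerLaw hP
  have hgM : gTilde h k J₀ lam B ≤ M := by
    refine max_le_max le_rfl (mul_le_mul_of_nonneg_left ?_ hlam0)
    refine mul_le_mul_of_nonneg_right ?_ hJ
    exact Real.rpow_le_rpow (zero_le_one.trans (one_le_pauliBase h)) (pauliBase_le h)
      (by positivity)
  have hg0 : 0 ≤ gTilde h k J₀ lam B := gTilde_nonneg i hP hl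
  set m := ⌈t / τ⌉₊ with hm
  have hm0 : 0 < m := Nat.ceil_pos.2 (by positivity)
  have hmR : (0 : ℝ) < m := by exact_mod_cast hm0
  have hmle : (m : ℝ) ≤ t / ε := by
    have h1 := (Nat.ceil_lt_add_one (a := t / τ) (by positivity)).le
    have h2 : 1 ≤ t / t₀ := (one_le_div ht₀).2 ht
    have h3 : t / ε = t / τ + t / t₀ := by rw [hε]; field_simp
    linarith
  by_cases hrm : m ≤ r
  -- `R = m * q` is the largest multiple of `m` not exceeding `r`. It is at least `r / 2`, which
  -- costs the factor `2 ^ (α - D)`.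
  · set q := r / m with hq
    have hq1 : 1 ≤ q := (Nat.one_le_div_iff hm0).2 hrm
    set R := m * q with hR
    have hRr : R ≤ r := Nat.mul_div_le r m
    have hR0 : 0 < R := Nat.mul_pos hm0 hq1
    have hr2 : (r : ℝ) / 2 ≤ R := by
      have h1 : r < m * (q + 1) := Nat.lt_mul_div_succ r hm0
      have h2 : m * (q + 1) ≤ 2 * R := by rw [hR]; nlinarith
      have h3 : (r : ℝ) ≤ 2 * R := by exact_mod_cast (h1.trans_le h2).le
      linarith
    have hΔτ : t / m ≤ τ := by
      rw [div_le_iff₀ hmR, mul_comm, ← div_le_iff₀ hτ0]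
      exact Nat.le_ceil _
    have hΔε : ε ≤ t / m := by
      rw [le_div_iff₀ hmR, mul_comm, ← le_div_iff₀ hε0]
      exact hmle
    have hsmall : 2 * Real.exp 1 * gTilde h k J₀ lam B * (t / m) < 1 := by
      have he : Real.exp 1 < 3 := by linarith [Real.exp_one_lt_d9]
      calc 2 * Real.exp 1 * gTilde h k J₀ lam B * (t / m) ≤ 2 * 3 * M * τ := by gcongr
        _ = M / (M + 1) := by rw [hτ]; field_simp; ring
        _ < 1 := by rw [div_lt_one (by positivity)]; linarith
    obtain ⟨W', hs, hf⟩ := exists_local_approximation hD hα hG hP hl hg ht0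
      (by positivity : 0 < t / m) hsmall (m := m) (R := R) (by field_simp) hR0 (dvd_mul_right m q)
      i hW hW1.le
    refine ⟨W', hs.mono (ball_mono G i hRr), hf.trans ?_⟩
    have e1 : (t / m) ^ x ≤ ε ^ x := Real.rpow_le_rpow_of_nonpos hε0 hΔε (by rw [hx]; linarith)
    have e2 : (R : ℝ) ^ (-α + (D : ℝ)) ≤ (2 : ℝ) ^ (α - D) * (r : ℝ) ^ (-α + (D : ℝ)) := by
      refine (Real.rpow_le_rpow_of_nonpos (by positivity) hr2 (by linarith)).trans_eq ?_
      rw [Real.div_rpow hr0.le (by norm_num), div_eq_mul_inv,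
        ← Real.rpow_neg (by norm_num : (0 : ℝ) ≤ 2), mul_comm]
      congr 2; ring
    calc 3 * gTilde h k J₀ lam B * γ / (α - D) * (t / m) ^ x * t ^ y * (R : ℝ) ^ (-α + (D : ℝ))
        ≤ 3 * M * γ / (α - D) * ε ^ x * t ^ y * ((2 : ℝ) ^ (α - D) * (r : ℝ) ^ (-α + (D : ℝ))) := by
          gcongr
      _ = C₁ * ((r : ℝ) ^ (-α + (D : ℝ)) * t ^ y) := by rw [hC₁]; ring
      _ ≤ (C₁ + C₂) * ((r : ℝ) ^ (-α + (D : ℝ)) * t ^ y) :=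
          mul_le_mul_of_nonneg_right (by linarith) hpos
      _ = _ := by ring
  · refine ⟨0, SupportedOn.zero _, ?_⟩
    have hH := isHermitian_hamiltonian hP
    have h1 : frobNorm (evolve (hamiltonian h) t W - 0) ≤ 1 := by
      rw [sub_zero]
      exact (frobNorm_evolve_le _ hH t W).trans ((frobNorm_le_opNorm W).trans hW1.le)
    have hrt : (r : ℝ) ≤ t / ε := by
      have : (r : ℝ) ≤ m := by exact_mod_cast (not_le.1 hrm).le
      linarith
    calc frobNorm (evolve (hamiltonian h) t W - 0) ≤ 1 := h1
      _ ≤ C₂ * ((r : ℝ) ^ (-α + (D : ℝ)) * t ^ y) :=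
          one_le_rpow_of_le_div (by linarith) hα hε0 ht₀ ht hr0 hrt
      _ ≤ (C₁ + C₂) * ((r : ℝ) ^ (-α + (D : ℝ)) * t ^ y) :=
          mul_le_mul_of_nonneg_right (by linarith) hpos
      _ = _ := by ring

/-- The polynomial growth of the OTOC, from a local approximation at all radii. -/
lemma otoc_le_rpow {Λ : Type*} [Fintype Λ] [DecidableEq Λ] {G : SimpleGraph Λ} {H W V : Op Λ}
    {D : ℕ} {α C t₀ t : ℝ} (hα : (D : ℝ) < α) (hC : 0 < C) (ht₀ : 0 < t₀) (ht : t₀ ≤ t)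
    (hH : H.IsHermitian) {i i' : Λ} {R : ℕ} (hR : 1 ≤ R) (hd : G.dist i i' = R)
    (hW : opNorm W ≤ 1) (hV : SupportedOn {i'} V) (hV1 : opNorm V ≤ 1)
    (happ : ∀ r : ℕ, 1 ≤ r → ∃ W' : Op Λ, SupportedOn (ball G i r) W' ∧
      frobNorm (evolve H t W - W') ≤ C * (r : ℝ) ^ (-α + D) * t ^ (α - ((D : ℝ) - 1) / 2)) :
    otoc H t W V ≤ ((4 * C * (2 : ℝ) ^ (α - D) + 4 * t₀ ^ (-(α - ((D : ℝ) - 1) / 2))) ^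
      (1 / (α - ((D : ℝ) - 1) / 2)) * t / (R : ℝ) ^ ((2 * α - 2 * D) / (2 * α - D + 1))) ^
        (α - ((D : ℝ) - 1) / 2) := by
  have hD0 : (0 : ℝ) ≤ D := Nat.cast_nonneg D
  have ht0 : 0 < t := ht₀.trans_le ht
  have hR0 : (0 : ℝ) < R := by exact_mod_cast hR
  set y : ℝ := α - ((D : ℝ) - 1) / 2 with hy
  have hy0 : 0 < y := by rw [hy]; linarith
  have h2y : 2 * α - D + 1 = 2 * y := by rw [hy]; ring
  set M : ℝ := 4 * C * (2 : ℝ) ^ (α - D) + 4 * t₀ ^ (-y) with hM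
  have hM0 : 0 < M := by positivity
  -- The denominator `2 * α - D + 1` equals `2 * y`, so the outer power `y` leaves exactly `R ^ (-(α
  -- - D))`.
  have hrhs : (M ^ (1 / y) * t / (R : ℝ) ^ ((2 * α - 2 * D) / (2 * α - D + 1))) ^ y =
      M * t ^ y * (R : ℝ) ^ (-α + (D : ℝ)) := by
    rw [Real.div_rpow (by positivity) (by positivity), Real.mul_rpow (by positivity) ht0.le,
      ← Real.rpow_mul hM0.le, ← Real.rpow_mul hR0.le, one_div_mul_cancel hy0.ne', Real.rpow_one,
      div_eq_mul_inv, ← Real.rpow_neg hR0.le, h2y]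
    congr 2
    field_simp
    ring
  rw [hrhs]
  have htriv : otoc H t W V ≤ 4 := by
    have h1 := otoc_le_of_commute (H := H) (W := W) (t := t) (W' := 0) hV1 (by simp)
    have h2 : frobNorm (evolve H t W - 0) ≤ 1 := by
      rw [sub_zero]
      exact (frobNorm_evolve_le _ hH t W).trans ((frobNorm_le_opNorm W).trans hW)
    have h3 := frobNorm_nonneg (evolve H t W - 0)
    nlinarith
  -- For `R = 1` the radius `R - 1` is zero, where no approximation is assumed. The trivial bound
  -- `4` and `t ≥ t₀` handle it, whence the second summand of `M`.
  rcases hR.eq_or_lt with rfl | hR2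
  · rw [Nat.cast_one, Real.one_rpow, mul_one]
    refine htriv.trans ?_
    have e1 : t₀ ^ y ≤ t ^ y := Real.rpow_le_rpow ht₀.le ht hy0.le
    calc (4 : ℝ) = 4 * t₀ ^ (-y) * t₀ ^ y := by
          rw [mul_assoc, ← Real.rpow_add ht₀]; simp
      _ ≤ M * t ^ y := by
          refine mul_le_mul ?_ e1 (by positivity) hM0.le
          rw [hM]
          have : 0 ≤ 4 * C * (2 : ℝ) ^ (α - D) := by positivity
          linarith
  · obtain ⟨W', hs, hf⟩ := happ (R - 1) (by omega)
    have h1 := otoc_le_of_ball (H := H) (W := W) (t := t) (by omega : R - 1 < G.dist i i') hV hV1 hs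
    set F := frobNorm (evolve H t W - W') with hF
    have hF0 : 0 ≤ F := frobNorm_nonneg _
    -- The bound `4 * F ^ 2` serves for `F ≤ 1` and the trivial bound `4` for `F ≥ 1`; the claimed
    -- exponent needs only the first power of `F`.
    have h2 : otoc H t W V ≤ 4 * F := by
      rcases le_total F 1 with h | h
      · nlinarith
      · linarith
    have hhalf : (R : ℝ) / 2 ≤ ((R - 1 : ℕ) : ℝ) := by
      rw [Nat.cast_sub hR]
      have : (2 : ℝ) ≤ R := by exact_mod_cast hR2
      push_cast
      linarith
    have e2 : ((R - 1 : ℕ) : ℝ) ^ (-α + (D : ℝ)) ≤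
        (2 : ℝ) ^ (α - D) * (R : ℝ) ^ (-α + (D : ℝ)) := by
      refine (Real.rpow_le_rpow_of_nonpos (by positivity) hhalf (by linarith)).trans_eq ?_
      rw [Real.div_rpow hR0.le (by norm_num), div_eq_mul_inv,
        ← Real.rpow_neg (by norm_num : (0 : ℝ) ≤ 2), mul_comm]
      congr 2; ring
    calc otoc H t W V ≤ 4 * F := h2
      _ ≤ 4 * (C * ((2 : ℝ) ^ (α - D) * (R : ℝ) ^ (-α + (D : ℝ))) * t ^ y) := by
          have : C * ((R - 1 : ℕ) : ℝ) ^ (-α + (D : ℝ)) * t ^ y ≤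
            C * ((2 : ℝ) ^ (α - D) * (R : ℝ) ^ (-α + (D : ℝ))) * t ^ y := by gcongr
          linarith
      _ = 4 * C * (2 : ℝ) ^ (α - D) * t ^ y * (R : ℝ) ^ (-α + (D : ℝ)) := by ring
      _ ≤ M * t ^ y * (R : ℝ) ^ (-α + (D : ℝ)) := by
          gcongr
          rw [hM]
          have : 0 ≤ 4 * t₀ ^ (-y) := by positivity
          linarith

end Uniform

end LongRange

end

theorem theorem1 (D k : ℕ) (hD : 1 ≤ D) (α γ J₀ : ℝ) (hα : (D : ℝ) < α) :
    -- the local approximation, with explicit constants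
    (∀ (Λ : Type u) [Fintype Λ] [DecidableEq Λ] (G : SimpleGraph Λ) (h : Finset Λ → Op Λ),
      IsLattice G D γ → IsPowerLaw G h k α J₀ →
      ∀ lam g : ℝ, IsConvConst G α lam → IsSiteEnergy h g →
      ∀ (t Δt : ℝ) (m R : ℕ), 0 < t → 0 < Δt → 2 * Real.exp 1 * gTilde h k J₀ lam g * Δt < 1 →
        t / Δt = m → 0 < R → m ∣ R →
      ∀ (i : Λ) (W : Op Λ), SupportedOn {i} W → opNorm W = 1 →
      ∃ W' : Op Λ, SupportedOn (ball G i R) W' ∧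
        frobNorm (evolve (hamiltonian h) t W - W') ≤
          (2 : ℝ) ^ (D - 1) * C₀ D α γ J₀ (gTilde h k J₀ lam g)
            * Δt ^ (-α + ((D : ℝ) + 1) / 2) * t ^ (α - ((D : ℝ) - 1) / 2)
            * (R : ℝ) ^ (-α + D)) ∧
    -- the OTOC is controlled by the error of any local approximation
    (∀ (Λ : Type u) [Fintype Λ] [DecidableEq Λ] (G : SimpleGraph Λ) (h : Finset Λ → Op Λ),
      IsLattice G D γ → IsPowerLaw G h k α J₀ →
      ∀ (t : ℝ) (i i' : Λ) (R : ℕ), 1 ≤ R → G.dist i i' = R →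
      ∀ W V W' : Op Λ, SupportedOn {i} W → opNorm W = 1 → SupportedOn {i'} V → opNorm V = 1 →
        SupportedOn (ball G i (R - 1)) W' →
        otoc (hamiltonian h) t W V ≤ 4 * frobNorm (evolve (hamiltonian h) t W - W') ^ 2) ∧
    -- the local approximation at all radii, and the polynomial growth of the OTOC, for times
    -- bounded away from zero, with constants that do not depend on the system
    (∀ t₀ : ℝ, 0 < t₀ → ∃ C C' : ℝ, 0 < C ∧ 0 < C' ∧
      ∀ (Λ : Type u) [Fintype Λ] [DecidableEq Λ] (G : SimpleGraph Λ) (h : Finset Λ → Op Λ),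
      IsLattice G D γ → IsPowerLaw G h k α J₀ →
      ∀ t : ℝ, t₀ ≤ t → ∀ (i : Λ) (W : Op Λ), SupportedOn {i} W → opNorm W = 1 →
        (∀ r : ℕ, 1 ≤ r → ∃ W' : Op Λ, SupportedOn (ball G i r) W' ∧
          frobNorm (evolve (hamiltonian h) t W - W') ≤
            C * (r : ℝ) ^ (-α + D) * t ^ (α - ((D : ℝ) - 1) / 2)) ∧
        (∀ (i' : Λ) (R : ℕ), 1 ≤ R → G.dist i i' = R →
          ∀ V : Op Λ, SupportedOn {i'} V → opNorm V = 1 →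
          otoc (hamiltonian h) t W V ≤
            (C' * t / (R : ℝ) ^ ((2 * α - 2 * D) / (2 * α - D + 1)))
              ^ (α - ((D : ℝ) - 1) / 2))) := by
  refine ⟨?_, ?_, ?_⟩
  · intro Λ _ _ G h hG hP lam g hl hg t Δt m R ht hΔ hsmall hm hR hmR i W hW hW1
    obtain ⟨W', hs, hf⟩ :=
      exists_local_approximation hD hα hG hP hl hg ht hΔ hsmall hm hR hmR i hW hW1.le
    refine ⟨W', hs, hf.trans ?_⟩
    have hC := three_mul_div_le_C₀ hD hα hG.one_le (nonneg_of_isPowerLaw i hP)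
      (gTilde_nonneg (g := g) i hP hl)
    gcongr
  · intro Λ _ _ G h hG hP t i i' R hR hd W V W' hW hW1 hV hV1 hW'
    exact otoc_le_of_ball (by omega) hV hV1.le hW'
  · intro t₀ ht₀
    -- The constants are chosen before any system is given. If these inequalities fail, no system
    -- with a site exists and any constants do.
    by_cases hsys : 1 ≤ γ ∧ 0 ≤ J₀
    · obtain ⟨C, hC, happ⟩ :=
        exists_uniform_local_approximation.{u} (k := k) hD hα hsys.1 hsys.2 ht₀
      refine ⟨C, _, hC, ?_, fun Λ _ _ G h hG hP t ht i W hW hW1 =>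
        ⟨happ Λ G h hG hP t ht i W hW hW1, fun i' R hR hd V hV hV1 =>
          otoc_le_rpow hα hC ht₀ ht (isHermitian_hamiltonian hP) hR hd hW1.le hV hV1.le
            (happ Λ G h hG hP t ht i W hW hW1)⟩⟩
      positivity
    · refine ⟨1, 1, one_pos, one_pos, fun Λ _ _ G h hG hP t ht i W hW hW1 => ?_⟩
      exact absurd ⟨hG.one_le, nonneg_of_isPowerLaw i hP⟩ hsys
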